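/- Let $(X,Y)$ be an $\mathbb{R}^d\times\mathbb{R}$-valued random couple, let $k\ge 0$ and $M\ge 1$ be fixed, and for $\ell\ge 1$ let $\mathcal{D}_n$, $n=k+\ell$, be a sample of $n$ iid copies of $(X,Y)$, independent of $(X,Y)$ and split into two parts $\mathcal{D}_k$ and $\mathcal{D}_\ell=\{(X_i,Y_i)\}_{i=1}^{\ell}$ of sizes $k$ and $\ell$. Let $r_{k,1},\dots,r_{k,M}:\mathbb{R}^d\to\mathbb{R}$ be (measurable) basic estimators constructed from $\mathcal{D}_k$ only, and put $\mathbf{r}_k(x)=(r_{k,1}(x),\dots,r_{k,M}(x))$. Assume that every $r_{k,m}$ is a bounded function of $x$ (the bound may depend on $\mathcal{D}_k$). Let $K:\mathbb{R}^M\to\mathbb{R}_+$ be a regular kernel: $K$ is a decreasing function of a norm, i.e. there is a norm $p$ on $\mathbb{R}^M$ such that $K(w)\le K(z)$ whenever $p(z)\le p(w)$, and there are $b,\kappa_0,\rho>0$ with $$b\,\mathbf{1}_{B(0,\rho)}(z)\le K(z)\le 1\ \ \text{for all } z\in\mathbb{R}^M,\qquad \int_{\mathbb{R}^M}\sup_{u\in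 B(z,\rho)}K(u)\,dz=\kappa_0<\infty,$$ where $B(c,s)$ is the open Euclidean ball with center $c$ and radius $s$. For a bandwidth $h>0$ put $K_h(z)=K(z/h)$ and $$g_n(\mathbf{r}_k(x))=\sum_{i=1}^{\ell}W_{n,i}(x)\,Y_i,\qquad W_{n,i}(x)=\frac{K_h(\mathbf{r}_k(X_i)-\mathbf{r}_k(x))}{\sum_{j=1}^{\ell}K_h(\mathbf{r}_k(X_j)-\mathbf{r}_k(x))},\qquad 0/0=0.$$ Let $g^*(x)=\mathbb{E}[Y\mid X=x]$, and let $g^*(\mathbf{r}_k(X))=\mathbb{E}[Y\mid \mathcal{D}_k,\mathbf{r}_k(X)]$ be the conditional expectation of $Y$ given the predictions, the data $\mathcal{D}_k$ that determine $\mathbf{r}_k$ being given as well. Let $h=h_\ell>0$ satisfy $h\to0$ and $h^M\ell\to\infty$ as $\ell\to\infty$. Then, for every distribution of $(X,Y)$ with $\mathbb{E}|Y|^2<\infty$, $$\mathbb{E}\big[|g_n(\mathbf{r}_k(X))-g^*(\mathbf{r}_k(X))|^2\big]\longrightarrow 0\quad\text{as }\ell\to\infty .$$ Thus $$\limsup_{\ell\to\infty}\mathbb{E}\big[|g_n(\mathbf{r}_k(X))-g^*(X)|^2\big]\le\inf_{f\in\mathcal{G}}\mathbb{E}\big[|f(\mathbf{r}_k(X))-g^*(X)|^2\big]\le\min_{1\le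 m\le M}\mathbb{E}\big[|r_{k,m}(X)-g^*(X)|^2\big],$$ where $\mathcal{G}$ is the class of the measurable functions $f:\mathbb{R}^M\to\mathbb{R}$ with $\mathbb{E}[|f(\mathbf{r}_k(X))|^2]<\infty$. All expectations are over $X$ and the whole sample $\mathcal{D}_n$. -/

import Mathlib

open MeasureTheory ProbabilityTheory Filter Topology
open scoped ENNReal

namespace KernelAggregation

/-- `ℝⁿ` with its Euclidean norm. -/
abbrev E (n : ℕ) : Type := EuclideanSpace ℝ (Fin n)

/-- A regular kernel on `ℝᴹ`: a decreasing function of a norm `p` on `ℝᴹ` (of the Euclidean norm for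
the Gaussian or the Epanechnikov kernel, of the sup norm for the naive kernel) that satisfies
`b 𝟙_{B(0,ρ)} ≤ K ≤ 1` and `∫ sup_{u ∈ B(z,ρ)} K(u) dz = κ₀ < ∞` for some `b, κ₀, ρ > 0`, where the
balls are open Euclidean balls. -/
structure IsRegularKernel {M : ℕ} (K : E M → ℝ) : Prop where
  decreasing : ∃ p : Seminorm ℝ (E M), (∀ z, p z = 0 → z = 0) ∧ ∀ z w, p z ≤ p w → K w ≤ K z
  regular : ∃ b κ₀ ρ : ℝ, 0 < b ∧ 0 < κ₀ ∧ 0 < ρ ∧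
    (∀ z, (Metric.ball (0 : E M) ρ).indicator (fun _ => b) z ≤ K z ∧ K z ≤ 1) ∧
    Integrable (fun z : E M => ⨆ u : Metric.ball z ρ, K u) ∧
    ∫ z : E M, (⨆ u : Metric.ball z ρ, K u) = κ₀

/-- The vector of predictions `(r₁(x), …, r_M(x))` at `x`. -/
noncomputable def predictions {d M : ℕ} (r : Fin M → E d → ℝ) (x : E d) : E M :=
  WithLp.toLp 2 (fun m => r m x)

/-- The weight `K_h(𝐫(Xᵢ) - 𝐫(x)) / ∑ⱼ K_h(𝐫(Xⱼ) - 𝐫(x))`, where `K_h(z) = K(z / h)` and `0 / 0 = 0`. -/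
noncomputable def weight {d M ℓ : ℕ} (K : E M → ℝ) (h : ℝ) (r : Fin M → E d → ℝ)
    (D : Fin ℓ → E d × ℝ) (x : E d) (i : Fin ℓ) : ℝ :=
  K (h⁻¹ • (predictions r (D i).1 - predictions r x)) /
    ∑ j, K (h⁻¹ • (predictions r (D j).1 - predictions r x))

/-- The aggregated estimator: the weighted average of the responses in the sample `D`. -/
noncomputable def aggregate {d M ℓ : ℕ} (K : E M → ℝ) (h : ℝ) (r : Fin M → E d → ℝ)
    (D : Fin ℓ → E d × ℝ) (x : E d) : ℝ :=
  ∑ i, weight K h r D x i * (D i).2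

section Sample

variable {Ω : Type*} [MeasurableSpace Ω]

/-- `S 0, S 1, …` are iid copies of `(X, Y)`, independent of the generic couple `(X, Y)` itself. -/
structure IsIIDSample {d : ℕ} (μ : Measure Ω) (X : Ω → E d) (Y : Ω → ℝ)
    (S : ℕ → Ω → E d × ℝ) : Prop where
  measurable : ∀ i, Measurable (S i)
  identDistrib : ∀ i, IdentDistrib (S i) (fun ω => (X ω, Y ω)) μ μ
  indep : iIndepFun (fun o : Option ℕ => o.elim (fun ω => (X ω, Y ω)) S) μ

/-- The sample `D_k`, on which the basic estimators are built: the first `k` observations. -/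
def sampleK {d : ℕ} (S : ℕ → Ω → E d × ℝ) (k : ℕ) (ω : Ω) : Fin k → E d × ℝ :=
  fun i => S i ω

/-- The sample `D_ℓ`, used for the aggregation: the next `ℓ` observations. -/
def sampleL {d : ℕ} (S : ℕ → Ω → E d × ℝ) (k ℓ : ℕ) (ω : Ω) : Fin ℓ → E d × ℝ :=
  fun i => S (k + i) ω

/-- The random vector of predictions `𝐫_k(X)`; the basic estimators `r` depend on the data `D_k`. -/
noncomputable def predX {d M k : ℕ} (r : (Fin k → E d × ℝ) → Fin M → E d → ℝ) (X : Ω → E d)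
    (S : ℕ → Ω → E d × ℝ) (ω : Ω) : E M :=
  predictions (r (sampleK S k ω)) (X ω)

/-- The random variable `g_n(𝐫_k(X))`, with `n = k + ℓ`. -/
noncomputable def gn {d M k : ℕ} (K : E M → ℝ) (h : ℝ) (ℓ : ℕ)
    (r : (Fin k → E d × ℝ) → Fin M → E d → ℝ) (X : Ω → E d) (S : ℕ → Ω → E d × ℝ) (ω : Ω) : ℝ :=
  aggregate K h (r (sampleK S k ω)) (sampleL S k ℓ ω) (X ω)

/-- The random variable `g*(X)`, where `g*(x) = 𝔼[Y | X = x]`. -/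
noncomputable def gstarX {d : ℕ} (μ : Measure Ω) (X : Ω → E d) (Y : Ω → ℝ) : Ω → ℝ :=
  μ[Y | MeasurableSpace.comap X inferInstance]

/-- The random variable `g*(𝐫_k(X))`: the conditional expectation of `Y` given the predictions
`𝐫_k(X)`, where the data `D_k`, and with them the functions `r_{k,m}`, are given as well. -/
noncomputable def gstarPred {d M k : ℕ} (μ : Measure Ω)
    (r : (Fin k → E d × ℝ) → Fin M → E d → ℝ) (X : Ω → E d) (Y : Ω → ℝ)
    (S : ℕ → Ω → E d × ℝ) : Ω → ℝ :=
  μ[Y | MeasurableSpace.comap (fun ω => (sampleK S k ω, predX r X S ω)) inferInstance]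

/-- The quadratic risk `𝔼|U - V|²`, as an element of `[0, ∞]`. -/
noncomputable def risk (μ : Measure Ω) (U V : Ω → ℝ) : ℝ≥0∞ :=
  ∫⁻ ω, ENNReal.ofReal (|U ω - V ω| ^ 2) ∂μ

/-- The class `𝒢` of the functions `f : ℝᴹ → ℝ` with `𝔼|f(𝐫_k(X))|² < ∞`. -/
def classG {d M k : ℕ} (μ : Measure Ω) (r : (Fin k → E d × ℝ) → Fin M → E d → ℝ) (X : Ω → E d)
    (S : ℕ → Ω → E d × ℝ) : Set (E M → ℝ) :=
  {f | Measurable f ∧ ∫⁻ ω, ENNReal.ofReal (|f (predX r X S ω)| ^ 2) ∂μ < ∞}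

end Sample

end KernelAggregation

/-!
The aggregate `g_n` is a kernel average `∑ⱼ Wⱼ Yⱼ`, so that `φ ↦ ∑ⱼ Wⱼ φ(Xⱼ, Yⱼ)` is a linear operator
on the square-integrable functions of an observation (and of the data `D_k`). Consistency follows from
a bound on these operators that is uniform in the sample size, the bandwidth and the predictions,
together with convergence on a dense class.

*Uniform bound.* The test point and the observations are exchangeable, so the second moment of the
kernel average at the test point is the mean over all points of the squares of the leave-one-out
averages. As the kernel decreases in a norm, these averages are dominated, up to a factor `2`, by the
centered maximal function of the counting measure of the points. A Besicovitch argument, a greedy choice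
of balls with an overlap bounded by a number of cones, gives the weak type `(1, 1)`, and Marcinkiewicz
interpolation gives the strong type `(2, 2)`, with a constant that depends on the norm only
(`sum_sq_average_le`, `IsRegularKernel.exists_secondMoment_kernelAverage_le`). Because the constant does
not see the predictions, no integrability in `D_k` of the bounds on the basic estimators is needed.

*Convergence.* Among points of a bounded set, those with fewer than `n` neighbors at distance `ρ h` number
at most a constant times `n / hᴹ`, by a grid argument. By exchangeability the denominator of the weights
at the test point is thus, with high probability, at least a small multiple of `hᴹ ℓ`, whereas
`K(w) ‖w‖ᴹ → 0` makes the total numerator of the far observations negligible against `hᴹ ℓ`. Hence the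
weights are asymptotically normalized, spread out and concentrated near the test point
(`IsRegularKernel.tendsto_measure_not_isGood`). For bounded continuous functions of the prediction, this
gives convergence, and density extends it to `L²`. For a function orthogonal to the functions of `D_k` and
of the prediction, such as `Y - 𝔼[Y | D_k, 𝐫_k(X)]`, the terms of the average are uncorrelated, so that
its second moment is that of `∑ⱼ Wⱼ² ψⱼ²`, which vanishes after truncation of `ψ`
(`IsRegularKernel.tendsto_secondMoment_of_orthogonal`).

The limsup of the risk is therefore at most the risk of `𝔼[Y | D_k, 𝐫_k(X)]`. Since `D_k` is independent of
`(X, Y)`, this variable is also the `L²` projection of `g*(X)` on the functions of `D_k` and `𝐫_k(X)`; this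
gives the comparison with `𝒢`, and the coordinate functions give the comparison with the basic estimators.
-/

namespace KernelAggregation

/-! ### Norms and cones -/

section Norms

variable {V : Type*} [NormedAddCommGroup V] [NormedSpace ℝ V] [FiniteDimensional ℝ V]

/-- A norm on a finite-dimensional space, given as a definite seminorm, is equivalent to the
ambient norm. -/
lemma exists_norm_equiv (p : Seminorm ℝ V) (hp : ∀ z, p z = 0 → z = 0) :
    ∃ a A : ℝ, 0 < a ∧ 0 < A ∧ ∀ z, a * ‖z‖ ≤ p z ∧ p z ≤ A * ‖z‖ := by
  have hcont : Continuous p := p.convexOn.locallyLipschitz.continuous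
  obtain ⟨A, hA0, hA⟩ := Seminorm.bound_of_continuous_normedSpace p hcont
  rcases subsingleton_or_nontrivial V with hV | hV
  · exact ⟨1, A, one_pos, hA0, fun z => ⟨by simp [Subsingleton.elim z 0], hA z⟩⟩
  obtain ⟨x₀, hx₀, hmin⟩ := (isCompact_sphere (0 : V) 1).exists_isMinOn
    (NormedSpace.sphere_nonempty.2 zero_le_one) hcont.continuousOn
  have hx₀' : ‖x₀‖ = 1 := by simpa using hx₀
  have hpx₀ : 0 < p x₀ := by
    refine (apply_nonneg p x₀).lt_of_ne fun h => ?_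
    rw [hp x₀ h.symm] at hx₀'
    simp at hx₀'
  refine ⟨p x₀, A, hpx₀, hA0, fun z => ⟨?_, hA z⟩⟩
  rcases eq_or_ne z 0 with rfl | hz
  · simp
  have hz' : 0 < ‖z‖ := norm_pos_iff.2 hz
  have h1 : p x₀ ≤ p (‖z‖⁻¹ • z) :=
    hmin (by simp [norm_smul, hz'.ne'])
  rw [map_smul_eq_mul, norm_inv, norm_norm, inv_mul_eq_div, le_div_iff₀ hz'] at h1
  exact h1

/-- Finitely many cones cover the space such that two points of the same cone are no farther from
each other than the farther one is from the apex. -/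
lemma exists_cone_coloring (p : Seminorm ℝ V) (hp : ∀ z, p z = 0 → z = 0) :
    ∃ (N : ℕ) (c : V → Fin N), ∀ x y, c x = c y → p (x - y) ≤ max (p x) (p y) := by
  obtain ⟨a, A, ha, hA, hpA⟩ := exists_norm_equiv p hp
  have hε : 0 < 1 / (2 * A) := by positivity
  obtain ⟨t, -, htfin, ht⟩ := (isCompact_closedBall (0 : V) (1 / a)).finite_cover_balls hε
  have hmem : ∀ x : V, ∃ y : t, dist ((p x)⁻¹ • x) y < 1 / (2 * A) := by
    intro x
    have hx : (p x)⁻¹ • x ∈ Metric.closedBall (0 : V) (1 / a) := by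
      rw [mem_closedBall_zero_iff, norm_smul, norm_inv, Real.norm_of_nonneg (apply_nonneg p x),
        le_div_iff₀ ha]
      rcases (apply_nonneg p x).eq_or_lt with h | h
      · rw [← h]; simp
      · rw [mul_assoc, inv_mul_le_iff₀ h, mul_one, mul_comm]; exact (hpA x).1
    obtain ⟨y, hy, hxy⟩ := Set.mem_iUnion₂.1 (ht hx)
    exact ⟨⟨y, hy⟩, hxy⟩
  choose c hc using hmem
  have := htfin.fintype
  refine ⟨Fintype.card t, fun x => Fintype.equivFin t (c x), ?_⟩
  have key : ∀ x y, c x = c y → p x ≤ p y → p (x - y) ≤ p y := by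
    intro x y hxy hle
    rcases (apply_nonneg p x).eq_or_lt with h | h
    · rw [hp x h.symm]; simp
    have hy : 0 < p y := h.trans_le hle
    have hd : p ((p x)⁻¹ • x - (p y)⁻¹ • y) ≤ 1 := by
      have h1 := hc x
      have h2 := hc y
      rw [← hxy] at h2
      have h3 : dist ((p x)⁻¹ • x) ((p y)⁻¹ • y) ≤ 1 / (2 * A) + 1 / (2 * A) :=
        (dist_triangle_right _ _ (c x : V)).trans (add_le_add h1.le h2.le)
      rw [dist_eq_norm] at h3
      calc _ ≤ A * ‖(p x)⁻¹ • x - (p y)⁻¹ • y‖ := (hpA _).2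
        _ ≤ A * (1 / (2 * A) + 1 / (2 * A)) := by gcongr
        _ = 1 := by field_simp; norm_num
    have hdecomp : x - y = p x • ((p x)⁻¹ • x - (p y)⁻¹ • y) + (-((p y - p x) * (p y)⁻¹)) • y := by
      have h1 : p x • ((p x)⁻¹ • x) = x := by rw [smul_smul, mul_inv_cancel₀ h.ne', one_smul]
      have h2 : ((p y - p x) * (p y)⁻¹) = 1 - p x * (p y)⁻¹ := by field_simp
      rw [smul_sub, h1, h2, smul_smul]
      module
    rw [hdecomp]
    refine (map_add_le_add p _ _).trans ?_
    rw [map_smul_eq_mul, map_smul_eq_mul, norm_neg, Real.norm_of_nonneg h.le,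
      Real.norm_of_nonneg (mul_nonneg (sub_nonneg.2 hle) (inv_nonneg.2 hy.le)), mul_assoc,
      inv_mul_cancel₀ hy.ne', mul_one]
    nlinarith
  intro x y hxy
  have hxy' : c x = c y := (Fintype.equivFin t).injective hxy
  rcases le_total (p x) (p y) with h | h
  · exact (key x y hxy' h).trans (le_max_right _ _)
  · rw [map_sub_rev p]
    exact (key y x hxy'.symm h).trans (le_max_left _ _)

end Norms

/-! ### Leave-one-out weights -/

section Weights

variable {V : Type*} [AddCommGroup V] {ι : Type*} [Fintype ι] [DecidableEq ι]

/-- The leave-one-out weights: `nbrWeight k z i j` is the weight that the kernel estimator at the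
point `z i`, based on the other points, gives to the point `z j`. -/
noncomputable def nbrWeight (k : V → ℝ) (z : ι → V) (i j : ι) : ℝ :=
  if j = i then 0 else k (z j - z i) / ∑ l ∈ Finset.univ.erase i, k (z l - z i)

lemma nbrWeight_nonneg {k : V → ℝ} (hk : ∀ x, 0 ≤ k x) (z : ι → V) (i j : ι) :
    0 ≤ nbrWeight k z i j := by
  unfold nbrWeight
  split_ifs
  · exact le_rfl
  · exact div_nonneg (hk _) (Finset.sum_nonneg fun _ _ => hk _)

lemma sum_nbrWeight_mul (k : V → ℝ) (z : ι → V) (i : ι) (f : ι → ℝ) :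
    ∑ j, nbrWeight k z i j * f j = (∑ j ∈ Finset.univ.erase i, k (z j - z i) * f j) /
      ∑ l ∈ Finset.univ.erase i, k (z l - z i) := by
  rw [← Finset.add_sum_erase _ _ (Finset.mem_univ i), Finset.sum_div]
  simp only [nbrWeight, if_true, zero_mul, zero_add]
  refine Finset.sum_congr rfl fun j hj => ?_
  rw [if_neg (Finset.ne_of_mem_erase hj)]
  ring

lemma sum_nbrWeight_le_one (k : V → ℝ) (z : ι → V) (i : ι) :
    ∑ j, nbrWeight k z i j ≤ 1 := by
  have := sum_nbrWeight_mul k z i 1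
  simp only [Pi.one_apply, mul_one] at this
  rw [this]
  exact div_self_le_one _

end Weights

/-! ### The centered maximal function of finitely many points -/

section Maximal

variable {V : Type*} [AddCommGroup V] [Module ℝ V] {ι : Type*}

/-- The greedy choice of the Besicovitch covering argument: among finitely many balls, some cover
all centers and none of them contains the center of another one. -/
lemma exists_greedy_subfamily (p : Seminorm ℝ V) (z : ι → V) (r : ι → ℝ) (hr : ∀ i, 0 ≤ r i)
    (A : Finset ι) :
    ∃ B ⊆ A, (∀ a ∈ A, ∃ i ∈ B, p (z a - z i) ≤ r i) ∧
      ∀ i ∈ B, ∀ j ∈ B, i ≠ j → max (r i) (r j) < p (z i - z j) := by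
  classical
  induction A using Finset.strongInduction with
  | H A ih =>
    rcases A.eq_empty_or_nonempty with rfl | hA
    · exact ⟨∅, by simp⟩
    obtain ⟨m, hm, hmax⟩ := A.exists_max_image r hA
    set A' := A.filter fun a => r m < p (z a - z m) with hA'
    have hlt : A' ⊂ A := by
      refine Finset.filter_ssubset.2 ⟨m, hm, ?_⟩
      simpa using hr m
    obtain ⟨B, hBA, hcov, hsep⟩ := ih A' hlt
    refine ⟨insert m B, ?_, ?_, ?_⟩
    · exact Finset.insert_subset hm (hBA.trans (Finset.filter_subset _ _))
    · intro a ha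
      by_cases h : r m < p (z a - z m)
      · obtain ⟨i, hi, hai⟩ := hcov a (Finset.mem_filter.2 ⟨ha, h⟩)
        exact ⟨i, Finset.mem_insert_of_mem hi, hai⟩
      · exact ⟨m, Finset.mem_insert_self _ _, not_lt.1 h⟩
    · have hB : ∀ j ∈ B, max (r m) (r j) < p (z j - z m) := by
        intro j hj
        have := Finset.mem_filter.1 (hBA hj)
        rw [max_eq_left (hmax j this.1)]
        exact this.2
      intro i hi j hj hij
      rcases Finset.mem_insert.1 hi with rfl | hi' <;>
        rcases Finset.mem_insert.1 hj with rfl | hj'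
      · exact absurd rfl hij
      · rw [map_sub_rev p]; exact hB j hj'
      · rw [max_comm]; exact hB i hi'
      · exact hsep i hi' j hj' hij

variable [Fintype ι]

/-- Weak type `(1, 1)` of the centered maximal function of a finite set of points. -/
lemma mul_card_le_of_ball_average {p : Seminorm ℝ V} {N : ℕ} {c : V → Fin N}
    (hc : ∀ x y, c x = c y → p (x - y) ≤ max (p x) (p y))
    (z : ι → V) (r : ι → ℝ) (hr : ∀ i, 0 ≤ r i) (f : ι → ℝ) (hf : ∀ i, 0 ≤ f i)
    {t : ℝ} (ht : 0 ≤ t) (A : Finset ι)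
    (hA : ∀ i ∈ A, t * (Finset.univ.filter fun j => p (z j - z i) ≤ r i).card ≤
      ∑ j with p (z j - z i) ≤ r i, f j) :
    t * A.card ≤ N * ∑ j, f j := by
  classical
  obtain ⟨B, hBA, hcov, hsep⟩ := exists_greedy_subfamily p z r hr A
  have hcard : A.card ≤ ∑ i ∈ B, (Finset.univ.filter fun j => p (z j - z i) ≤ r i).card := by
    refine (Finset.card_le_card fun a ha => ?_).trans Finset.card_biUnion_le
    obtain ⟨i, hi, h⟩ := hcov a ha
    exact Finset.mem_biUnion.2 ⟨i, hi, by simpa using h⟩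
  have hover : ∀ j, (B.filter fun i => p (z j - z i) ≤ r i).card ≤ N := by
    intro j
    refine (Finset.card_le_card_of_injOn (fun i => c (z i - z j)) (t := Finset.univ)
      (fun _ _ => Finset.mem_coe.2 (Finset.mem_univ _)) ?_).trans (by simp)
    intro i hi l hl hil
    simp only [Finset.coe_filter, Set.mem_ofPred_eq] at hi hl
    by_contra hne
    have h1 := hc _ _ hil
    rw [sub_sub_sub_cancel_right] at h1
    refine absurd (h1.trans (max_le_max ?_ ?_)) (not_le.2 (hsep i hi.1 l hl.1 hne))
    · rw [map_sub_rev p]; exact hi.2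
    · rw [map_sub_rev p]; exact hl.2
  calc t * A.card
      ≤ t * (∑ i ∈ B, (Finset.univ.filter fun j => p (z j - z i) ≤ r i).card : ℕ) := by
        gcongr
    _ = ∑ i ∈ B, t * (Finset.univ.filter fun j => p (z j - z i) ≤ r i).card := by
        rw [Nat.cast_sum, Finset.mul_sum]
    _ ≤ ∑ i ∈ B, ∑ j with p (z j - z i) ≤ r i, f j := Finset.sum_le_sum fun i hi => hA i (hBA hi)
    _ = ∑ j, (B.filter fun i => p (z j - z i) ≤ r i).card * f j := by
        simp_rw [Finset.sum_filter]
        rw [Finset.sum_comm]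
        refine Finset.sum_congr rfl fun j _ => ?_
        rw [← Finset.sum_filter, Finset.sum_const, nsmul_eq_mul]
    _ ≤ ∑ j, N * f j := Finset.sum_le_sum fun j _ =>
        mul_le_mul_of_nonneg_right (by exact_mod_cast hover j) (hf j)
    _ = N * ∑ j, f j := by rw [Finset.mul_sum]

/-- Layer-cake form of Abel summation. -/
lemma sum_mul_nonpos_of_superlevel {s : Finset ι} {k a : ι → ℝ} (hk : ∀ j, 0 ≤ k j)
    (h : ∀ t, 0 < t → ∑ j ∈ s with t ≤ k j, a j ≤ 0) : ∑ j ∈ s, k j * a j ≤ 0 := by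
  classical
  have hrep : ∀ j, k j * a j =
      ∫ t in Set.Ioc 0 (∑ l, k l), (Set.Iic (k j)).indicator (fun _ => a j) t := by
    intro j
    have hle : k j ≤ ∑ l, k l := Finset.single_le_sum (fun l _ => hk l) (Finset.mem_univ j)
    rw [setIntegral_indicator measurableSet_Iic, setIntegral_const, Set.Ioc_inter_Iic,
      min_eq_right hle, Real.volume_real_Ioc_of_le (hk j), sub_zero, smul_eq_mul]
  simp_rw [hrep]
  rw [← integral_finsetSum]
  · refine setIntegral_nonpos measurableSet_Ioc fun t ht => ?_
    have := h t ht.1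
    rw [Finset.sum_filter] at this
    simpa [Set.indicator_apply] using this
  · intro j _
    exact (integrable_const (a j)).indicator measurableSet_Iic

variable [DecidableEq ι]

/-- Weak type `(1, 1)` of the leave-one-out averages, which for a kernel that decreases in a norm are
dominated by the centered maximal function. -/
lemma mul_card_lt_average_le {p : Seminorm ℝ V} {N : ℕ} {c : V → Fin N}
    (hc : ∀ x y, c x = c y → p (x - y) ≤ max (p x) (p y))
    {k : V → ℝ} (hk : ∀ x, 0 ≤ k x) (hkp : ∀ x y, p x ≤ p y → k y ≤ k x)
    (z : ι → V) (f : ι → ℝ) (hf : ∀ i, 0 ≤ f i) {t : ℝ} (ht : 0 ≤ t) :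
    t * (Finset.univ.filter fun i => t < ∑ j, nbrWeight k z i j * f j).card ≤
      2 * N * ∑ j, f j := by
  set A := Finset.univ.filter fun i => t < ∑ j, nbrWeight k z i j * f j with hA
  have hrad : ∀ i ∈ A, ∃ r, 0 ≤ r ∧
      t / 2 * (Finset.univ.filter fun j => p (z j - z i) ≤ r).card ≤
        ∑ j with p (z j - z i) ≤ r, f j := by
    intro i hi
    have hi' : t < ∑ j, nbrWeight k z i j * f j := (Finset.mem_filter.1 hi).2
    rw [sum_nbrWeight_mul] at hi'
    set s := Finset.univ.erase i with hs
    have hS : 0 < ∑ l ∈ s, k (z l - z i) := by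
      refine (Finset.sum_nonneg fun l _ => hk _).lt_of_ne fun h => ?_
      rw [← h, div_zero] at hi'
      exact absurd hi' (not_lt.2 ht)
    rw [lt_div_iff₀ hS] at hi'
    have hsuper : ∃ u, 0 < u ∧ 0 < ∑ j ∈ s with u ≤ k (z j - z i), (f j - t) := by
      by_contra hcon
      push Not at hcon
      have := sum_mul_nonpos_of_superlevel (s := s) (k := fun j => k (z j - z i))
        (a := fun j => f j - t) (fun _ => hk _) hcon
      simp_rw [mul_sub, Finset.sum_sub_distrib, ← Finset.sum_mul] at this
      linarith
    obtain ⟨u, hu, hpos⟩ := hsuper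
    set su := s.filter fun j => u ≤ k (z j - z i) with hsu
    have hne : su.Nonempty := by
      by_contra h
      rw [Finset.not_nonempty_iff_eq_empty.1 h] at hpos
      simp at hpos
    obtain ⟨m, hm, hmax⟩ := su.exists_max_image (fun j => p (z j - z i)) hne
    refine ⟨p (z m - z i), apply_nonneg p _, ?_⟩
    -- the superlevel set of the kernel is the punctured ball around `z i`
    have hball : (Finset.univ.filter fun j => p (z j - z i) ≤ p (z m - z i)) = insert i su := by
      ext j
      simp only [Finset.mem_filter, Finset.mem_univ, true_and, Finset.mem_insert]
      constructor
      · intro hj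
        by_cases hji : j = i
        · exact Or.inl hji
        · refine Or.inr (Finset.mem_filter.2 ⟨Finset.mem_erase.2 ⟨hji, Finset.mem_univ _⟩, ?_⟩)
          exact (Finset.mem_filter.1 hm).2.trans (hkp _ _ hj)
      · rintro (rfl | hj)
        · simp
        · exact hmax j hj
    have hisu : i ∉ su := fun h => by simp [hsu, hs] at h
    rw [hball, Finset.card_insert_of_notMem hisu, Finset.sum_insert hisu]
    rw [Finset.sum_sub_distrib, Finset.sum_const, nsmul_eq_mul] at hpos
    have hcard : (1 : ℝ) ≤ su.card := by exact_mod_cast hne.card_pos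
    have := hf i
    push_cast
    nlinarith
  choose! r hr hball using hrad
  have := mul_card_le_of_ball_average hc z (fun i => max (r i) 0) (fun i => le_max_right _ _) f hf
    (by positivity : 0 ≤ t / 2) A (fun i hi => by simpa only [max_eq_left (hr i hi)] using hball i hi)
  linarith

end Maximal

/-! ### Interpolation: the uniform `ℓ²` bound -/

section StrongType

variable {V : Type*} [AddCommGroup V] [Module ℝ V] {ι : Type*} [Fintype ι] [DecidableEq ι]

/-- Strong type `(2, 2)` of the leave-one-out averages, from the weak type by Marcinkiewicz
interpolation with the trivial bound on bounded functions. The constant depends on the norm only. -/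
lemma sum_sq_average_le {p : Seminorm ℝ V} {N : ℕ} {c : V → Fin N}
    (hc : ∀ x y, c x = c y → p (x - y) ≤ max (p x) (p y))
    {k : V → ℝ} (hk : ∀ x, 0 ≤ k x) (hkp : ∀ x y, p x ≤ p y → k y ≤ k x)
    (z : ι → V) (f : ι → ℝ) (hf : ∀ i, 0 ≤ f i) :
    ∑ i, (∑ j, nbrWeight k z i j * f j) ^ 2 ≤ 16 * N * ∑ j, f j ^ 2 := by
  set T : ι → ℝ := fun i => ∑ j, nbrWeight k z i j * f j with hT
  have hT0 : ∀ i, 0 ≤ T i := fun i =>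
    Finset.sum_nonneg fun j _ => mul_nonneg (nbrWeight_nonneg hk z i j) (hf j)
  set B : ℝ := ∑ i, T i + ∑ j, 2 * f j with hB
  have hTB : ∀ i, T i ≤ B := fun i => by
    have h1 := Finset.single_le_sum (fun l _ => hT0 l) (Finset.mem_univ i)
    have h2 : 0 ≤ ∑ j, 2 * f j := Finset.sum_nonneg fun j _ => mul_nonneg zero_le_two (hf j)
    linarith
  have hfB : ∀ j, 2 * f j ≤ B := fun j => by
    have h1 := Finset.single_le_sum (f := fun j => 2 * f j)
      (fun l _ => mul_nonneg zero_le_two (hf l)) (Finset.mem_univ j)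
    have h2 : 0 ≤ ∑ i, T i := Finset.sum_nonneg fun i _ => hT0 i
    linarith
  have hweak : ∀ t, 0 ≤ t → t * (Finset.univ.filter fun i => t < T i).card ≤
      4 * N * ∑ j with t < 2 * f j, f j := by
    intro t ht
    set g : ι → ℝ := fun j => if t < 2 * f j then f j else 0 with hg
    have h1 := mul_card_lt_average_le hc hk hkp z g (fun i => by
      simp only [hg]; split_ifs; exacts [hf i, le_rfl]) (by positivity : 0 ≤ t / 2)
    have h2 : (Finset.univ.filter fun i => t < T i).card ≤
        (Finset.univ.filter fun i => t / 2 < ∑ j, nbrWeight k z i j * g j).card := by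
      refine Finset.card_le_card fun i hi => ?_
      simp only [Finset.mem_filter, Finset.mem_univ, true_and] at hi ⊢
      have h3 : T i ≤ ∑ j, nbrWeight k z i j * g j + ∑ j, nbrWeight k z i j * (t / 2) := by
        rw [← Finset.sum_add_distrib]
        refine Finset.sum_le_sum fun j _ => ?_
        rw [← mul_add]
        refine mul_le_mul_of_nonneg_left ?_ (nbrWeight_nonneg hk z i j)
        simp only [hg]
        split_ifs <;> linarith
      rw [← Finset.sum_mul] at h3
      nlinarith [sum_nbrWeight_le_one k z i]
    have h4 : ((Finset.univ.filter fun i => t < T i).card : ℝ) ≤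
        (Finset.univ.filter fun i => t / 2 < ∑ j, nbrWeight k z i j * g j).card := by
      exact_mod_cast h2
    rw [Finset.sum_filter]
    nlinarith
  have hsq : ∀ i, T i ^ 2 =
      ∫ t in Set.Ioc 0 B, (Set.Iio (T i)).indicator (fun t => 2 * t) t := by
    intro i
    rw [setIntegral_indicator measurableSet_Iio]
    have : Set.Ioc 0 B ∩ Set.Iio (T i) = Set.Ioo 0 (T i) := by
      ext t; simp only [Set.mem_inter_iff, Set.mem_Ioc, Set.mem_Iio, Set.mem_Ioo]
      exact ⟨fun h => ⟨h.1.1, h.2⟩, fun h => ⟨⟨h.1, h.2.le.trans (hTB i)⟩, h.2⟩⟩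
    rw [this, ← integral_Ioc_eq_integral_Ioo, ← intervalIntegral.integral_of_le (hT0 i),
      intervalIntegral.integral_const_mul, integral_id]
    ring
  have hlin : ∀ j, 2 * f j ^ 2 =
      ∫ t in Set.Ioc 0 B, (Set.Iio (2 * f j)).indicator (fun _ => f j) t := by
    intro j
    rw [setIntegral_indicator measurableSet_Iio]
    have : Set.Ioc 0 B ∩ Set.Iio (2 * f j) = Set.Ioo 0 (2 * f j) := by
      ext t; simp only [Set.mem_inter_iff, Set.mem_Ioc, Set.mem_Iio, Set.mem_Ioo]
      exact ⟨fun h => ⟨h.1.1, h.2⟩, fun h => ⟨⟨h.1, h.2.le.trans (hfB j)⟩, h.2⟩⟩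
    rw [this, setIntegral_const, Real.volume_real_Ioo_of_le (mul_nonneg zero_le_two (hf j)),
      smul_eq_mul]
    ring
  have hint : ∀ i, Integrable ((Set.Iio (T i)).indicator fun t : ℝ => 2 * t)
      (volume.restrict (Set.Ioc 0 B)) := fun i =>
    ((continuous_const.mul continuous_id).integrableOn_Ioc).indicator measurableSet_Iio
  have hint' : ∀ j, Integrable ((Set.Iio (2 * f j)).indicator fun _ : ℝ => f j)
      (volume.restrict (Set.Ioc 0 B)) := fun j =>
    (integrable_const (f j)).indicator measurableSet_Iio
  calc ∑ i, T i ^ 2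
      = ∫ t in Set.Ioc 0 B, ∑ i, (Set.Iio (T i)).indicator (fun t => 2 * t) t := by
        rw [integral_finsetSum _ fun i _ => hint i]
        exact Finset.sum_congr rfl fun i _ => hsq i
    _ ≤ ∫ t in Set.Ioc 0 B, 8 * N * ∑ j, (Set.Iio (2 * f j)).indicator (fun _ => f j) t := by
        refine setIntegral_mono_on (integrable_finsetSum _ fun i _ => hint i)
          ((integrable_finsetSum _ fun j _ => hint' j).const_mul _) measurableSet_Ioc
          fun t ht => ?_
        have := hweak t ht.1.le
        rw [Finset.card_eq_sum_ones, Nat.cast_sum, Finset.sum_filter, Finset.sum_filter] at this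
        have h1 : ∑ i, (Set.Iio (T i)).indicator (fun t => 2 * t) t =
            2 * (t * ∑ i, if t < T i then (1 : ℝ) else 0) := by
          rw [Finset.mul_sum, Finset.mul_sum]
          refine Finset.sum_congr rfl fun i _ => ?_
          simp [Set.indicator_apply]
        have h2 : ∑ j, (Set.Iio (2 * f j)).indicator (fun _ => f j) t =
            ∑ j, if t < 2 * f j then f j else 0 := by
          simp [Set.indicator_apply]
        rw [h1, h2]
        push_cast at this
        linarith
    _ = 16 * N * ∑ j, f j ^ 2 := by
        rw [integral_const_mul, integral_finsetSum _ fun j _ => hint' j]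
        simp_rw [← hlin]
        rw [← Finset.mul_sum]
        ring

end StrongType

/-! ### Isolated points are few -/

section Counting

/-- Among points of a bounded set, few have fewer than `n` others within distance `ρ h`: a cell of a
grid of mesh proportional to `h` contains at most `n` such points. -/
lemma exists_card_sparse_le (M : ℕ) {R ρ : ℝ} (hR : 0 ≤ R) (hρ : 0 < ρ) :
    ∃ C : ℝ, 0 ≤ C ∧ ∀ h : ℝ, 0 < h → h ≤ 1 → ∀ {ι : Type} [Fintype ι] [DecidableEq ι]
      (z : ι → E M), (∀ i, ‖z i‖ ≤ R) → ∀ n : ℕ,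
      ((Finset.univ.filter fun i =>
        ((Finset.univ.erase i).filter fun j => ‖z j - z i‖ < ρ * h).card < n).card : ℝ) ≤
        n * (C / h ^ M) := by
  refine ⟨(2 * R * (M + 1) / ρ + 2) ^ M, by positivity, ?_⟩
  intro h hh hh1 ι _ _ z hz n
  set δ : ℝ := ρ * h / (M + 1) with hδ
  have hδ0 : 0 < δ := by positivity
  set t : Finset (Fin M → ℤ) := Fintype.piFinset fun _ => Finset.Icc ⌊-R / δ⌋ ⌊R / δ⌋ with ht
  set g : ι → Fin M → ℤ := fun i m => ⌊z i m / δ⌋ with hg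
  have hgt : ∀ i, g i ∈ t := by
    intro i
    refine Fintype.mem_piFinset.2 fun m => Finset.mem_Icc.2 ?_
    have h1 : |z i m| ≤ R := (PiLp.norm_apply_le (z i) m).trans (hz i)
    rw [abs_le] at h1
    exact ⟨Int.floor_le_floor (by gcongr; exact h1.1), Int.floor_le_floor (by gcongr; exact h1.2)⟩
  have hnear : ∀ i j, g i = g j → ‖z j - z i‖ < ρ * h := by
    intro i j hij
    have hcoord : ∀ m, ‖(z j - z i) m‖ ^ 2 ≤ δ ^ 2 := by
      intro m
      have h1 : ⌊z i m / δ⌋ = ⌊z j m / δ⌋ := congrFun hij m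
      have h2 := Int.abs_sub_lt_one_of_floor_eq_floor h1
      rw [← sub_div, abs_div, abs_of_pos hδ0, div_lt_one hδ0, abs_sub_comm] at h2
      have h3 : ‖(z j - z i) m‖ ≤ δ := h2.le
      gcongr
    have h1 : ‖z j - z i‖ ^ 2 ≤ M * δ ^ 2 := by
      rw [EuclideanSpace.norm_sq_eq]
      refine (Finset.sum_le_sum fun m _ => hcoord m).trans (by simp)
    have h2 : ρ * h = (M + 1) * δ := by rw [hδ]; field_simp
    refine lt_of_pow_lt_pow_left₀ 2 (by positivity) (h1.trans_lt ?_)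
    rw [h2, mul_pow]
    gcongr
    have : (0 : ℝ) ≤ M := Nat.cast_nonneg M
    nlinarith
  have hcard : (t.card : ℝ) ≤ (2 * R * (M + 1) / ρ + 2) ^ M / h ^ M := by
    rw [ht, Fintype.card_piFinset, Finset.prod_const, Finset.card_univ, Fintype.card_fin,
      Int.card_Icc, ← div_pow, Nat.cast_pow]
    refine pow_le_pow_left₀ (Nat.cast_nonneg _) ?_ M
    have h1 : ⌊-R / δ⌋ ≤ ⌊R / δ⌋ + 1 := by
      have : ⌊-R / δ⌋ ≤ ⌊R / δ⌋ := Int.floor_le_floor (by gcongr; linarith)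
      linarith
    have h2 : (((⌊R / δ⌋ + 1 - ⌊-R / δ⌋).toNat : ℕ) : ℝ) = ⌊R / δ⌋ + 1 - ⌊-R / δ⌋ := by
      have : (((⌊R / δ⌋ + 1 - ⌊-R / δ⌋).toNat : ℕ) : ℤ) = ⌊R / δ⌋ + 1 - ⌊-R / δ⌋ :=
        Int.toNat_of_nonneg (by linarith)
      exact_mod_cast this
    rw [h2]
    have h3 := Int.floor_le (R / δ)
    have h4 := Int.lt_floor_add_one (-R / δ)
    have h5 : R / δ = R * (M + 1) / ρ / h := by rw [hδ]; field_simp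
    have h6 : (2 : ℝ) ≤ 2 / h := by rw [le_div_iff₀ hh]; linarith
    calc (⌊R / δ⌋ : ℝ) + 1 - ⌊-R / δ⌋ ≤ 2 * (R / δ) + 2 := by rw [neg_div] at h4 ⊢; linarith
      _ ≤ 2 * (R * (M + 1) / ρ / h) + 2 / h := by rw [h5]; linarith
      _ = (2 * R * (M + 1) / ρ + 2) / h := by ring
  set A := Finset.univ.filter fun i =>
    ((Finset.univ.erase i).filter fun j => ‖z j - z i‖ < ρ * h).card < n with hA
  have hfib : A.card ≤ n * t.card := by
    refine Finset.card_le_mul_card_image_of_maps_to (f := g) (fun i _ => hgt i) n fun b _ => ?_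
    rcases (A.filter fun i => g i = b).eq_empty_or_nonempty with h0 | ⟨i, hi⟩
    · rw [h0]; simp
    have hi' := Finset.mem_filter.1 hi
    have hsub : (A.filter fun j => g j = b) ⊆
        insert i ((Finset.univ.erase i).filter fun j => ‖z j - z i‖ < ρ * h) := by
      intro j hj
      rcases eq_or_ne j i with rfl | hji
      · exact Finset.mem_insert_self _ _
      refine Finset.mem_insert_of_mem (Finset.mem_filter.2
        ⟨Finset.mem_erase.2 ⟨hji, Finset.mem_univ _⟩, hnear i j ?_⟩)
      rw [hi'.2, (Finset.mem_filter.1 hj).2]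
    have h1 := (Finset.card_le_card hsub).trans (Finset.card_insert_le _ _)
    have h2 : _ < n := (Finset.mem_filter.1 hi'.1).2
    omega
  calc (A.card : ℝ) ≤ n * t.card := by exact_mod_cast hfib
    _ ≤ _ := by gcongr

end Counting

/-! ### Regular kernels -/

section Kernel

variable {M : ℕ} {K : E M → ℝ}

lemma IsRegularKernel.nonneg (hK : IsRegularKernel K) (z : E M) : 0 ≤ K z := by
  obtain ⟨b, -, ρ, hb, -, -, hbK, -⟩ := hK.regular
  exact (Set.indicator_nonneg (fun _ _ => hb.le) z).trans (hbK z).1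

lemma IsRegularKernel.le_one (hK : IsRegularKernel K) (z : E M) : K z ≤ 1 := by
  obtain ⟨b, -, ρ, hb, -, -, hbK, -⟩ := hK.regular
  exact (hbK z).2

lemma IsRegularKernel.measurable (hK : IsRegularKernel K) : Measurable K := by
  obtain ⟨p, hp, hdec⟩ := hK.decreasing
  have hcont : Continuous p := p.convexOn.locallyLipschitz.continuous
  refine measurable_of_Ici fun u => ?_
  -- a superlevel set of the kernel is the preimage of a lower set of reals under the norm
  have hpre : K ⁻¹' Set.Ici u = p ⁻¹' {t | ∃ w, t ≤ p w ∧ u ≤ K w} := by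
    ext z
    exact ⟨fun hz => ⟨z, le_rfl, hz⟩, fun ⟨w, hzw, hw⟩ => le_trans hw (hdec z w hzw)⟩
  rw [hpre]
  refine hcont.measurable (Set.OrdConnected.measurableSet ?_)
  refine IsLowerSet.ordConnected fun a b' hab ⟨w, h1, h2⟩ => ⟨w, hab.trans h1, h2⟩

lemma IsRegularKernel.integrable (hK : IsRegularKernel K) : Integrable K := by
  obtain ⟨b, -, ρ, hb, -, hρ, -, hint, -⟩ := hK.regular
  refine hint.mono' hK.measurable.aestronglyMeasurable (Eventually.of_forall fun z => ?_)
  rw [Real.norm_of_nonneg (hK.nonneg z)]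
  exact le_ciSup (f := fun u : Metric.ball z ρ => K u)
    ⟨1, by rintro _ ⟨u, rfl⟩; exact hK.le_one u⟩ ⟨z, Metric.mem_ball_self hρ⟩

/-- An integrable kernel that decreases in a norm is `o(‖w‖⁻ᴹ)` at infinity: its values on a ball of
radius proportional to `‖w‖`, far from the origin, are at least `K w`. -/
lemma IsRegularKernel.exists_tail_le (hK : IsRegularKernel K) {ε : ℝ} (hε : 0 < ε) :
    ∃ R : ℝ, 0 < R ∧ ∀ w, R ≤ ‖w‖ → K w * ‖w‖ ^ M ≤ ε := by
  obtain ⟨p, hp, hdec⟩ := hK.decreasing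
  obtain ⟨a, A, ha, hA, hpA⟩ := exists_norm_equiv p hp
  set α : ℝ := a / A with hα
  have hα0 : 0 < α := by positivity
  set v : ℝ := volume.real (Metric.ball (0 : E M) 1) with hv
  have hv0 : 0 < v := ENNReal.toReal_pos (Metric.measure_ball_pos _ _ one_pos).ne'
    measure_ball_lt_top.ne
  have htail : Tendsto (fun n : ℕ => ∫ u in {u : E M | (n : ℝ) ≤ ‖u‖}, K u) atTop (𝓝 0) := by
    have := tendsto_setIntegral_of_antitone (μ := volume) (f := K)
      (s := fun n : ℕ => {u : E M | (n : ℝ) ≤ ‖u‖})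
      (fun n => measurableSet_le measurable_const measurable_norm)
      (fun m n hmn u (hu : (n : ℝ) ≤ ‖u‖) => le_trans (Nat.cast_le.2 hmn) hu)
      ⟨0, hK.integrable.integrableOn⟩
    have hempty : (⋂ n : ℕ, {u : E M | (n : ℝ) ≤ ‖u‖}) = ∅ := by
      ext u
      simp only [Set.mem_iInter, Set.mem_ofPred_eq, Set.mem_empty_iff_false, iff_false, not_forall,
        not_le]
      exact exists_nat_gt _
    rwa [hempty, setIntegral_empty] at this
  have hε' : 0 < ε * ((α / 4) ^ M * v) := by positivity
  obtain ⟨n, hn⟩ := (htail.eventually (gt_mem_nhds hε')).exists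
  refine ⟨2 * (n + 1) / α, by positivity, fun w hw => ?_⟩
  have hw0 : 0 < ‖w‖ := lt_of_lt_of_le (by positivity) hw
  have hnw : (n : ℝ) ≤ α / 2 * ‖w‖ := by
    rw [div_le_iff₀ hα0] at hw; linarith
  set s := Metric.ball ((3 * α / 4) • w) (α / 4 * ‖w‖) with hs
  have hsb : ∀ u ∈ s, (n : ℝ) ≤ ‖u‖ ∧ K w ≤ K u := by
    intro u hu
    have h1 : ‖u - (3 * α / 4) • w‖ < α / 4 * ‖w‖ := by
      rw [← dist_eq_norm]; exact hu
    have h2 : ‖(3 * α / 4) • w‖ = 3 * α / 4 * ‖w‖ := by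
      rw [norm_smul, Real.norm_of_nonneg (by positivity)]
    have h3 := norm_sub_norm_le u ((3 * α / 4) • w)
    have h4 := norm_sub_norm_le ((3 * α / 4) • w) u
    rw [norm_sub_rev] at h4
    refine ⟨by linarith, hdec _ _ ?_⟩
    calc p u ≤ A * ‖u‖ := (hpA u).2
      _ ≤ A * (α * ‖w‖) := by gcongr; linarith
      _ = a * ‖w‖ := by rw [hα]; field_simp
      _ ≤ p w := (hpA w).1
  have hvol : volume.real s = (α / 4 * ‖w‖) ^ M * v := by
    rw [hs, hv, measureReal_def, measureReal_def,
      Measure.addHaar_ball_of_pos _ _ (by positivity : 0 < α / 4 * ‖w‖), ENNReal.toReal_mul,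
      ENNReal.toReal_ofReal (by positivity)]
    simp
  have hle : K w * ((α / 4 * ‖w‖) ^ M * v) ≤ ∫ u in {u : E M | (n : ℝ) ≤ ‖u‖}, K u := by
    calc K w * ((α / 4 * ‖w‖) ^ M * v) = ∫ _ in s, K w := by
          rw [setIntegral_const, hvol, smul_eq_mul, mul_comm]
      _ ≤ ∫ u in s, K u := setIntegral_mono_on
          (integrableOn_const measure_ball_lt_top.ne) hK.integrable.integrableOn
          measurableSet_ball fun u hu => (hsb u hu).2
      _ ≤ _ := setIntegral_mono_set hK.integrable.integrableOn
          (Eventually.of_forall hK.nonneg) (Eventually.of_forall fun u hu => (hsb u hu).1)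
  have h5 : K w * ‖w‖ ^ M * ((α / 4) ^ M * v) ≤ ε * ((α / 4) ^ M * v) := by
    have : (α / 4 * ‖w‖) ^ M = (α / 4) ^ M * ‖w‖ ^ M := mul_pow _ _ _
    rw [this] at hle
    linarith
  exact le_of_mul_le_mul_right h5 (by positivity)

end Kernel

/-! ### Exchangeability and resampling -/

section Exchangeable

variable {𝒮 : Type*} [MeasurableSpace 𝒮] (ν : Measure 𝒮) [IsProbabilityMeasure ν]
  {ι : Type} [Fintype ι]

lemma measurePreserving_comp_perm (σ : Equiv.Perm ι) :
    MeasurePreserving (fun w : ι → 𝒮 => w ∘ σ) (Measure.pi fun _ => ν) (Measure.pi fun _ => ν) := by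
  have := measurePreserving_piCongrLeft (fun _ : ι => ν) σ.symm
  convert this using 1
  ext w i
  rw [MeasurableEquiv.coe_piCongrLeft]
  have := Equiv.piCongrLeft_apply_apply (fun _ : ι => 𝒮) σ.symm w (σ i)
  simpa using this.symm

/-- In an iid sample all points play the same role, so that a quantity attached to one point can be
averaged over all points. -/
lemma card_mul_lintegral_eq [DecidableEq ι] {F : ι → (ι → 𝒮) → ℝ≥0∞} (hF : ∀ i, Measurable (F i))
    (hσ : ∀ (σ : Equiv.Perm ι) i w, F i (w ∘ σ) = F (σ i) w) (i₀ : ι) :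
    (Fintype.card ι : ℝ≥0∞) * ∫⁻ w, F i₀ w ∂(Measure.pi fun _ => ν) =
      ∫⁻ w, ∑ i, F i w ∂(Measure.pi fun _ => ν) := by
  rw [lintegral_finsetSum _ fun i _ => hF i]
  have : ∀ i, ∫⁻ w, F i w ∂(Measure.pi fun _ => ν) = ∫⁻ w, F i₀ w ∂(Measure.pi fun _ => ν) := by
    intro i
    rw [← (measurePreserving_comp_perm ν (Equiv.swap i₀ i)).lintegral_comp (hF i₀)]
    refine lintegral_congr fun w => ?_
    rw [hσ, Equiv.swap_apply_left]
  simp [this]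

/-- Resampling one entry of an iid sample does not change its law. -/
lemma measurePreserving_update [DecidableEq ι] (i : ι) :
    MeasurePreserving (fun q : (ι → 𝒮) × 𝒮 => Function.update q.1 i q.2)
      ((Measure.pi fun _ => ν).prod ν) (Measure.pi fun _ => ν) := by
  have hm : Measurable (fun q : (ι → 𝒮) × 𝒮 => Function.update q.1 i q.2) := by
    refine measurable_pi_iff.2 fun l => ?_
    rcases eq_or_ne l i with rfl | h
    · simpa using measurable_snd
    · simpa [h] using measurable_fst.eval
  refine ⟨hm, (Measure.pi_eq fun t ht => ?_).symm⟩
  rw [Measure.map_apply hm (MeasurableSet.univ_pi ht)]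
  have hpre : (fun q : (ι → 𝒮) × 𝒮 => Function.update q.1 i q.2) ⁻¹' Set.univ.pi t =
      (Set.univ.pi (Function.update t i Set.univ)) ×ˢ t i := by
    ext q
    simp only [Set.mem_preimage, Set.mem_univ_pi, Set.mem_prod]
    constructor
    · refine fun h => ⟨fun l => ?_, by simpa using h i⟩
      rcases eq_or_ne l i with rfl | hl
      · simp
      · simpa [hl] using h l
    · rintro ⟨h, hi⟩ l
      rcases eq_or_ne l i with rfl | hl
      · simpa using hi
      · simpa [hl] using h l
  rw [hpre, Measure.prod_prod, Measure.pi_pi, ← Finset.mul_prod_erase _ _ (Finset.mem_univ i),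
    ← Finset.mul_prod_erase _ (fun l => ν (t l)) (Finset.mem_univ i)]
  simp only [Function.update_self, measure_univ, one_mul]
  rw [mul_comm]
  congr 1
  refine Finset.prod_congr rfl fun l hl => ?_
  rw [Function.update_of_ne (Finset.ne_of_mem_erase hl)]

end Exchangeable

/-! ### Kernel weights at a random sample -/

section Weights

variable {M : ℕ} {K : E M → ℝ}

/-- The rescaled kernel `K_h(x) = K(x / h)`. -/
noncomputable def scaled (K : E M → ℝ) (h : ℝ) (x : E M) : ℝ := K (h⁻¹ • x)

lemma IsRegularKernel.measurable_scaled (hK : IsRegularKernel K) (h : ℝ) :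
    Measurable (scaled K h) :=
  hK.measurable.comp (measurable_const_smul _)

lemma IsRegularKernel.scaled_nonneg (hK : IsRegularKernel K) (h : ℝ) (x : E M) :
    0 ≤ scaled K h x := hK.nonneg _

lemma abs_nbrWeight_le_one {k : E M → ℝ} (hk : ∀ x, 0 ≤ k x) {ι : Type} [Fintype ι]
    [DecidableEq ι] (z : ι → E M) (i j : ι) : |nbrWeight k z i j| ≤ 1 := by
  rw [abs_of_nonneg (nbrWeight_nonneg hk z i j)]
  exact (Finset.single_le_sum (f := nbrWeight k z i) (fun l _ => nbrWeight_nonneg hk z i l)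
    (Finset.mem_univ j)).trans (sum_nbrWeight_le_one k z i)

lemma nbrWeight_comp_perm {V : Type*} [AddCommGroup V] (k : V → ℝ) {ι : Type} [Fintype ι]
    [DecidableEq ι] (z : ι → V) (σ : Equiv.Perm ι) (i j : ι) :
    nbrWeight k (z ∘ σ) i j = nbrWeight k z (σ i) (σ j) := by
  unfold nbrWeight
  simp only [σ.injective.eq_iff, Function.comp_apply]
  congr 2
  refine Finset.sum_equiv σ (fun l => ?_) fun l _ => rfl
  simp

lemma measurable_nbrWeight {k : E M → ℝ} (hk : Measurable k) {ι : Type} [Fintype ι]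
    [DecidableEq ι] {α : Type*} [MeasurableSpace α] {z : α → ι → E M}
    (hz : ∀ i, Measurable fun a => z a i) (i j : ι) :
    Measurable fun a => nbrWeight k (z a) i j := by
  unfold nbrWeight
  split_ifs
  · exact measurable_const
  · exact (hk.comp ((hz j).sub (hz i))).div
      (Finset.measurable_fun_sum _ fun l _ => hk.comp ((hz l).sub (hz i)))

/-- The constant of the leave-one-out `ℓ²` bound depends on the kernel only, not on the bandwidth,
the number of points or their position. -/
lemma IsRegularKernel.exists_sum_sq_average_le (hK : IsRegularKernel K) :
    ∃ C : ℝ, 0 ≤ C ∧ ∀ h : ℝ, 0 < h → ∀ {ι : Type} [Fintype ι] [DecidableEq ι] (z : ι → E M)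
      (f : ι → ℝ), ∑ i, (∑ j, nbrWeight (scaled K h) z i j * |f j|) ^ 2 ≤ C * ∑ j, f j ^ 2 := by
  obtain ⟨p, hp, hdec⟩ := hK.decreasing
  obtain ⟨N, c, hc⟩ := exists_cone_coloring p hp
  refine ⟨16 * N, by positivity, fun h hh ι _ _ z f => ?_⟩
  refine (sum_sq_average_le hc (hK.scaled_nonneg h) (fun x y hxy => hdec _ _ ?_) z
    (fun j => |f j|) (fun j => abs_nonneg _)).trans_eq (by simp only [sq_abs])
  rw [map_smul_eq_mul, map_smul_eq_mul]
  gcongr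

/-- Uniformly bounded `L²` operators: the kernel average of a function of the observations has, up
to a constant that depends on the kernel only, at most the second moment of this function. -/
lemma IsRegularKernel.exists_lintegral_average_sq_le (hK : IsRegularKernel K) :
    ∃ C : ℝ, 0 ≤ C ∧ ∀ h : ℝ, 0 < h → ∀ {ι : Type} [Fintype ι] [DecidableEq ι] (i₀ : ι)
      {𝒮 : Type*} [MeasurableSpace 𝒮] (ν : Measure 𝒮) [IsProbabilityMeasure ν]
      (Z : 𝒮 → E M) (_ : Measurable Z) (f : 𝒮 → ℝ) (_ : Measurable f),
      ∫⁻ w, ENNReal.ofReal ((∑ j, nbrWeight (scaled K h) (Z ∘ w) i₀ j * |f (w j)|) ^ 2)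
          ∂(Measure.pi fun _ : ι => ν) ≤
        ENNReal.ofReal C * ∫⁻ s, ENNReal.ofReal (f s ^ 2) ∂ν := by
  obtain ⟨C, hC, hbound⟩ := hK.exists_sum_sq_average_le
  refine ⟨C, hC, fun h hh ι _ _ i₀ 𝒮 _ ν _ Z hZ f hf => ?_⟩
  set F : ι → (ι → 𝒮) → ℝ≥0∞ := fun i w =>
    ENNReal.ofReal ((∑ j, nbrWeight (scaled K h) (Z ∘ w) i j * |f (w j)|) ^ 2) with hF
  have hFm : ∀ i, Measurable (F i) := fun i => by
    refine ENNReal.measurable_ofReal.comp ((Finset.measurable_fun_sum _ fun j _ => ?_).pow_const 2)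
    exact (measurable_nbrWeight (hK.measurable_scaled h)
      (fun l => hZ.comp (measurable_pi_apply l)) i j).mul
      (hf.comp (measurable_pi_apply j)).abs
  have hFσ : ∀ (σ : Equiv.Perm ι) i w, F i (w ∘ σ) = F (σ i) w := fun σ i w => by
    simp only [hF, ← Function.comp_assoc, nbrWeight_comp_perm]
    congr 2
    exact Equiv.sum_comp σ fun j => nbrWeight (scaled K h) (Z ∘ w) (σ i) j * |f (w j)|
  have hcard := card_mul_lintegral_eq ν hFm hFσ i₀
  have hle : ∫⁻ w, ∑ i, F i w ∂(Measure.pi fun _ => ν) ≤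
      (Fintype.card ι : ℝ≥0∞) * (ENNReal.ofReal C * ∫⁻ s, ENNReal.ofReal (f s ^ 2) ∂ν) := by
    have hfm : Measurable fun s => ENNReal.ofReal (f s ^ 2) :=
      ENNReal.measurable_ofReal.comp (hf.pow_const 2)
    calc ∫⁻ w, ∑ i, F i w ∂(Measure.pi fun _ => ν)
        ≤ ∫⁻ w, ENNReal.ofReal C * ∑ j, ENNReal.ofReal (f (w j) ^ 2)
            ∂(Measure.pi fun _ : ι => ν) := by
          refine lintegral_mono fun w => ?_
          simp only [hF]
          rw [← ENNReal.ofReal_sum_of_nonneg fun i _ => sq_nonneg _,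
            ← ENNReal.ofReal_sum_of_nonneg fun i _ => sq_nonneg _, ← ENNReal.ofReal_mul hC]
          exact ENNReal.ofReal_le_ofReal (hbound h hh (Z ∘ w) fun j => f (w j))
      _ = ENNReal.ofReal C * ∑ j : ι, ∫⁻ s, ENNReal.ofReal (f s ^ 2) ∂ν := by
          have hfj : ∀ j : ι, Measurable fun w : ι → 𝒮 => ENNReal.ofReal (f (w j) ^ 2) :=
            fun j => hfm.comp (measurable_pi_apply j)
          rw [lintegral_const_mul _ (Finset.measurable_fun_sum _ fun j _ => hfj j),
            lintegral_finsetSum _ fun j _ => hfj j]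
          congr 1
          refine Finset.sum_congr rfl fun j _ => ?_
          exact (measurePreserving_eval (fun _ : ι => ν) j).lintegral_comp hfm
      _ = _ := by
          rw [Finset.sum_const, Finset.card_univ, nsmul_eq_mul]; ring
  rw [← hcard] at hle
  have hne : (Fintype.card ι : ℝ≥0∞) ≠ 0 := by
    have : Nonempty ι := ⟨i₀⟩
    exact_mod_cast Fintype.card_ne_zero
  exact (ENNReal.mul_le_mul_iff_right hne (ENNReal.natCast_ne_top _)).1 hle

end Weights

/-! ### Configurations with many near observations -/

section GoodConfigurations

variable {M : ℕ} {K : E M → ℝ}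

/-- The weights at the point `z i` are normalized, spread over many points, and concentrated near
`z i`. -/
def IsGood {ι : Type} [Fintype ι] [DecidableEq ι] (k : E M → ℝ) (ε δ : ℝ) (i : ι) (z : ι → E M) :
    Prop :=
  ∑ j, nbrWeight k z i j = 1 ∧ ∑ j, nbrWeight k z i j ^ 2 ≤ ε ∧
    (∑ j, if δ ≤ ‖z j - z i‖ then nbrWeight k z i j else 0) ≤ ε

lemma measurableSet_isGood {ι : Type} [Fintype ι] [DecidableEq ι] {k : E M → ℝ}
    (hk : Measurable k) (ε δ : ℝ) (i : ι) {α : Type*} [MeasurableSpace α] {z : α → ι → E M}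
    (hz : ∀ i, Measurable fun a => z a i) : MeasurableSet {a | IsGood k ε δ i (z a)} := by
  have hw := fun j => measurable_nbrWeight hk hz i j
  have hfar : ∀ j, Measurable fun a =>
      if δ ≤ ‖z a j - z a i‖ then nbrWeight k (z a) i j else 0 := fun j =>
    Measurable.ite (measurableSet_le measurable_const ((hz j).sub (hz i)).norm) (hw j)
      measurable_const
  have h1 : MeasurableSet {a | ∑ j, nbrWeight k (z a) i j = 1} :=
    measurableSet_eq_fun (Finset.measurable_fun_sum _ fun j _ => hw j) measurable_const
  have h2 : MeasurableSet {a | ∑ j, nbrWeight k (z a) i j ^ 2 ≤ ε} :=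
    measurableSet_le (Finset.measurable_fun_sum _ fun j _ => (hw j).pow_const 2) measurable_const
  have h3 : MeasurableSet
      {a | (∑ j, if δ ≤ ‖z a j - z a i‖ then nbrWeight k (z a) i j else 0) ≤ ε} :=
    measurableSet_le (Finset.measurable_fun_sum _ fun j _ => hfar j) measurable_const
  exact h1.inter (h2.inter h3)

/-- A configuration is good once `n` points lie within distance `ρ h` of `z i`, because then the
denominator of the weights is at least `b n`. -/
lemma isGood_of_le_card (hK : IsRegularKernel K) {b ρ h κ ε δ : ℝ} (hb : 0 < b) (hh : 0 < h)
    (hκ0 : 0 ≤ κ) (hbK : ∀ x, ‖x‖ < ρ → b ≤ K x) (hκ : ∀ x, δ / h ≤ ‖x‖ → K x ≤ κ)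
    {ι : Type} [Fintype ι] [DecidableEq ι] (i : ι) (z : ι → E M) {n : ℕ} (hn : 0 < n)
    (hcard : n ≤ ((Finset.univ.erase i).filter fun j => ‖z j - z i‖ < ρ * h).card)
    (h1 : 1 / (b * n) ≤ ε) (h2 : (Finset.univ.erase i).card * κ / (b * n) ≤ ε) :
    IsGood (scaled K h) ε δ i z := by
  set s := Finset.univ.erase i with hs
  set S := ∑ l ∈ s, scaled K h (z l - z i) with hS
  have hn' : (0 : ℝ) < n := by exact_mod_cast hn
  have hSn : b * n ≤ S := by
    calc b * n ≤ b * (s.filter fun j => ‖z j - z i‖ < ρ * h).card := by gcongr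
      _ = ∑ j ∈ s with ‖z j - z i‖ < ρ * h, b := by rw [Finset.sum_const, nsmul_eq_mul, mul_comm]
      _ ≤ ∑ j ∈ s with ‖z j - z i‖ < ρ * h, scaled K h (z j - z i) := by
          refine Finset.sum_le_sum fun j hj => hbK _ ?_
          rw [norm_smul, norm_inv, Real.norm_of_nonneg hh.le, inv_mul_lt_iff₀ hh, mul_comm]
          exact (Finset.mem_filter.1 hj).2
      _ ≤ S := Finset.sum_le_sum_of_subset_of_nonneg (Finset.filter_subset _ _)
          fun _ _ _ => hK.scaled_nonneg _ _
  have hbn : 0 < b * n := by positivity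
  have hS0 : 0 < S := hbn.trans_le hSn
  have hw : ∀ j, nbrWeight (scaled K h) z i j ≤ 1 / (b * n) := by
    intro j
    unfold nbrWeight
    split_ifs
    · positivity
    · exact div_le_div₀ zero_le_one (hK.le_one _) hbn hSn
  refine ⟨?_, ?_, ?_⟩
  · have := sum_nbrWeight_mul (scaled K h) z i 1
    simp only [Pi.one_apply, mul_one] at this
    rw [this]
    exact div_self hS0.ne'
  · calc ∑ j, nbrWeight (scaled K h) z i j ^ 2
        ≤ ∑ j, 1 / (b * n) * nbrWeight (scaled K h) z i j := by
          refine Finset.sum_le_sum fun j _ => ?_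
          rw [sq]
          exact mul_le_mul_of_nonneg_right (hw j) (nbrWeight_nonneg (hK.scaled_nonneg h) z i j)
      _ ≤ 1 / (b * n) := by
          rw [← Finset.mul_sum]
          exact mul_le_of_le_one_right (by positivity) (sum_nbrWeight_le_one _ _ _)
      _ ≤ ε := h1
  · have hfar : ∀ j ∈ s, (if δ ≤ ‖z j - z i‖ then nbrWeight (scaled K h) z i j else 0) ≤
        κ / (b * n) := by
      intro j hj
      split_ifs with hd
      · rw [nbrWeight, if_neg (Finset.ne_of_mem_erase hj)]
        refine div_le_div₀ hκ0 (hκ _ ?_) hbn hSn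
        rw [norm_smul, norm_inv, Real.norm_of_nonneg hh.le, div_eq_inv_mul]
        gcongr
      · positivity
    rw [← Finset.add_sum_erase _ _ (Finset.mem_univ i)]
    have h0 : (if δ ≤ ‖z i - z i‖ then nbrWeight (scaled K h) z i i else 0) = 0 := by
      simp [nbrWeight]
    rw [h0, zero_add]
    refine (Finset.sum_le_sum hfar).trans ?_
    rw [Finset.sum_const, nsmul_eq_mul, ← mul_div_assoc]
    exact h2

variable {𝒮 : Type*} [MeasurableSpace 𝒮]

/-- By exchangeability, an observation rarely has few neighbors. -/
lemma exists_measure_sparse_le {R ρ : ℝ} (hR : 0 ≤ R) (hρ : 0 < ρ) :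
    ∃ C : ℝ, 0 ≤ C ∧ ∀ h : ℝ, 0 < h → h ≤ 1 → ∀ {ι : Type} [Fintype ι] [DecidableEq ι] (i₀ : ι)
      (ν : Measure 𝒮) [IsProbabilityMeasure ν] (Z : 𝒮 → E M) (_ : Measurable Z)
      (_ : ∀ s, ‖Z s‖ ≤ R) (n : ℕ),
      (Fintype.card ι : ℝ≥0∞) * (Measure.pi fun _ : ι => ν) {w | ((Finset.univ.erase i₀).filter
        fun j => ‖Z (w j) - Z (w i₀)‖ < ρ * h).card < n} ≤ ENNReal.ofReal (n * (C / h ^ M)) := by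
  obtain ⟨C, hC, hcount⟩ := exists_card_sparse_le M hR hρ
  refine ⟨C, hC, fun h hh hh1 ι _ _ i₀ ν _ Z hZ hZR n => ?_⟩
  set A : ι → Set (ι → 𝒮) := fun i => {w | ((Finset.univ.erase i).filter
        fun j => ‖Z (w j) - Z (w i)‖ < ρ * h).card < n} with hA
  have hAm : ∀ i, MeasurableSet (A i) := by
    intro i
    have hm : Measurable fun w : ι → 𝒮 =>
        ((Finset.univ.erase i).filter fun j => ‖Z (w j) - Z (w i)‖ < ρ * h).card := by
      simp only [Finset.card_filter]
      refine Finset.measurable_fun_sum _ fun j _ => Measurable.ite ?_ measurable_const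
        measurable_const
      exact measurableSet_lt ((hZ.comp (measurable_pi_apply j)).sub
        (hZ.comp (measurable_pi_apply i))).norm measurable_const
    exact measurableSet_lt hm measurable_const
  have hσ : ∀ (σ : Equiv.Perm ι) i w, (A i).indicator (1 : (ι → 𝒮) → ℝ≥0∞) (w ∘ σ) =
      (A (σ i)).indicator 1 w := by
    intro σ i w
    have : ((Finset.univ.erase i).filter fun j => ‖Z ((w ∘ σ) j) - Z ((w ∘ σ) i)‖ < ρ * h).card =
        ((Finset.univ.erase (σ i)).filter fun j => ‖Z (w j) - Z (w (σ i))‖ < ρ * h).card := by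
      refine Finset.card_equiv σ fun j => ?_
      simp
    simp only [Set.indicator_apply, hA, Set.mem_ofPred_eq, this, Pi.one_apply]
  have hcard := card_mul_lintegral_eq ν (fun i => measurable_one.indicator (hAm i)) hσ i₀
  rw [lintegral_indicator_one (hAm i₀)] at hcard
  rw [hcard]
  calc ∫⁻ w, ∑ i, (A i).indicator 1 w ∂(Measure.pi fun _ => ν)
      ≤ ∫⁻ _, ENNReal.ofReal (n * (C / h ^ M)) ∂(Measure.pi fun _ : ι => ν) := by
        refine lintegral_mono fun w => ?_
        have h1 := hcount h hh hh1 (fun i => Z (w i)) (fun i => hZR _) n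
        rw [Finset.card_filter, Nat.cast_sum] at h1
        have h2 : ∑ i, (A i).indicator (1 : (ι → 𝒮) → ℝ≥0∞) w =
            ENNReal.ofReal (∑ i, ((if ((Finset.univ.erase i).filter
              fun j => ‖Z (w j) - Z (w i)‖ < ρ * h).card < n then 1 else 0 : ℕ) : ℝ)) := by
          rw [ENNReal.ofReal_sum_of_nonneg fun i _ => Nat.cast_nonneg _]
          refine Finset.sum_congr rfl fun i _ => ?_
          simp only [Set.indicator_apply, hA, Set.mem_ofPred_eq, Pi.one_apply]
          split_ifs <;> simp
        rw [h2]
        exact ENNReal.ofReal_le_ofReal h1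
    _ = ENNReal.ofReal (n * (C / h ^ M)) := by simp

/-- Configurations are good with probability tending to one. -/
lemma IsRegularKernel.tendsto_measure_not_isGood (hK : IsRegularKernel K) {h : ℕ → ℝ}
    (hpos : ∀ ℓ, 0 < h ℓ) (hzero : Tendsto h atTop (𝓝 0))
    (hinf : Tendsto (fun ℓ : ℕ => h ℓ ^ M * (ℓ : ℝ)) atTop atTop)
    (ν : Measure 𝒮) [IsProbabilityMeasure ν] {Z : 𝒮 → E M} (hZ : Measurable Z)
    {R : ℝ} (hZR : ∀ s, ‖Z s‖ ≤ R) {ε δ : ℝ} (hε : 0 < ε) (hδ : 0 < δ) :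
    Tendsto (fun ℓ : ℕ => (Measure.pi fun _ : Option (Fin ℓ) => ν)
      {w | ¬ IsGood (scaled K (h ℓ)) ε δ none (Z ∘ w)}) atTop (𝓝 0) := by
  obtain ⟨b, -, ρ, hb, -, hρ, hbK, -⟩ := hK.regular
  have hbK' : ∀ x, ‖x‖ < ρ → b ≤ K x := fun x hx => by
    have := (hbK x).1
    rwa [Set.indicator_of_mem (by simpa using hx)] at this
  obtain ⟨C, hC, hsparse⟩ := exists_measure_sparse_le (𝒮 := 𝒮) (M := M)
    (le_max_right R 0) hρ
  refine ENNReal.tendsto_nhds_zero.2 fun η hη => ?_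
  obtain ⟨η', hη', hη'η⟩ : ∃ η' : ℝ, 0 < η' ∧ ENNReal.ofReal η' ≤ η := by
    rcases eq_or_ne η ∞ with rfl | htop
    · exact ⟨1, one_pos, le_top⟩
    · exact ⟨η.toReal, ENNReal.toReal_pos hη.ne' htop, (ENNReal.ofReal_toReal htop).le⟩
  -- `n` is about `t h ^ M ℓ`, where `t` is so small that few points have fewer than `n` neighbors
  set t : ℝ := η' / (2 * (C + 1)) with ht
  have ht0 : 0 < t := by positivity
  have htC : t * C ≤ η' / 2 := by
    rw [ht, div_mul_eq_mul_div, div_le_div_iff₀ (by positivity) two_pos]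
    nlinarith
  set τ : ℝ := ε * δ ^ M * b * t with hτ
  have hτ0 : 0 < τ := by positivity
  obtain ⟨R₀, hR₀, htail⟩ := hK.exists_tail_le hτ0
  have hh1 : ∀ᶠ ℓ in atTop, h ℓ < 1 := hzero.eventually (gt_mem_nhds one_pos)
  have hh2 : ∀ᶠ ℓ in atTop, h ℓ < δ / R₀ := hzero.eventually (gt_mem_nhds (by positivity))
  have ha1 := hinf.eventually_ge_atTop (1 / (t * b * ε))
  have ha2 := hinf.eventually_ge_atTop (2 * C / η')
  have ha3 := hinf.eventually_gt_atTop 0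
  filter_upwards [hh1, hh2, ha1, ha2, ha3] with ℓ hℓ1 hℓ2 hℓ3 hℓ4 hℓ5
  refine le_trans ?_ hη'η
  have hh := hpos ℓ
  set a : ℝ := h ℓ ^ M * (ℓ : ℝ) with ha
  set n : ℕ := ⌈t * a⌉₊ with hn
  have hn1 : t * a ≤ n := Nat.le_ceil _
  have hn2 : (n : ℝ) < t * a + 1 := Nat.ceil_lt_add_one (by positivity)
  have hn0 : 0 < n := Nat.ceil_pos.2 (by positivity)
  have hℓ0 : (0 : ℝ) < ℓ := by
    rcases Nat.eq_zero_or_pos ℓ with h0 | h0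
    · rw [ha, h0] at hℓ5; simp at hℓ5
    · exact_mod_cast h0
  have hsub : {w : Option (Fin ℓ) → 𝒮 | ¬ IsGood (scaled K (h ℓ)) ε δ none (Z ∘ w)} ⊆
      {w | ((Finset.univ.erase none).filter
        fun j => ‖Z (w j) - Z (w none)‖ < ρ * h ℓ).card < n} := by
    intro w hw
    by_contra hcon
    refine hw (isGood_of_le_card hK hb hh (κ := τ / (δ / h ℓ) ^ M) (by positivity) hbK'
      ?_ none (Z ∘ w) hn0 (not_lt.1 hcon) ?_ ?_)
    · intro x hx
      have hδh : 0 < δ / h ℓ := by positivity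
      have hR₀x : R₀ ≤ ‖x‖ := by
        refine le_trans ?_ hx
        rw [le_div_iff₀ hh]
        rw [lt_div_iff₀ hR₀] at hℓ2
        linarith
      rw [le_div_iff₀ (by positivity)]
      refine le_trans ?_ (htail x hR₀x)
      have := hK.nonneg x
      gcongr
    · rw [div_le_iff₀ (by positivity)]
      rw [div_le_iff₀ (by positivity)] at hℓ3
      calc 1 ≤ a * (t * b * ε) := hℓ3
        _ = ε * (b * (t * a)) := by ring
        _ ≤ ε * (b * n) := by gcongr
    · have hc : (Finset.univ.erase (none : Option (Fin ℓ))).card = ℓ := by simp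
      rw [hc, div_le_iff₀ (by positivity)]
      calc ℓ * (τ / (δ / h ℓ) ^ M) = ε * (b * (t * a)) := by
            rw [hτ, ha, div_pow]; field_simp
        _ ≤ ε * (b * n) := by gcongr
  refine (measure_mono hsub).trans ?_
  have hmain := hsparse (h ℓ) hh hℓ1.le (none : Option (Fin ℓ)) ν Z hZ
    (fun s => (hZR s).trans (le_max_left _ _)) n
  have hc : (Fintype.card (Option (Fin ℓ)) : ℝ≥0∞) = ENNReal.ofReal (ℓ + 1) := by
    rw [Fintype.card_option, Fintype.card_fin, ← ENNReal.ofReal_natCast]; simp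
  rw [hc, mul_comm, ← ENNReal.le_div_iff_mul_le (Or.inl (by simp; positivity))
    (Or.inl ENNReal.ofReal_ne_top), ← ENNReal.ofReal_div_of_pos (by positivity)] at hmain
  refine hmain.trans (ENNReal.ofReal_le_ofReal ?_)
  have hCa : C ≤ η' / 2 * a := by
    rw [div_le_iff₀ hη'] at hℓ4; linarith
  calc n * (C / h ℓ ^ M) / (ℓ + 1) ≤ n * (C / h ℓ ^ M) / ℓ := by gcongr; linarith
    _ = n * C / a := by rw [ha]; field_simp
    _ ≤ (t * a + 1) * C / a := by gcongr
    _ ≤ η' := by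
      rw [div_le_iff₀ hℓ5]
      nlinarith

end GoodConfigurations

/-! ### Second moments -/

section SecondMoment

variable {α : Type*} [MeasurableSpace α]

/-- The second moment `∫ f²`, as an element of `[0, ∞]`. -/
noncomputable def secondMoment (μ : Measure α) (f : α → ℝ) : ℝ≥0∞ :=
  ∫⁻ a, ENNReal.ofReal (f a ^ 2) ∂μ

lemma secondMoment_eq_eLpNorm_sq (μ : Measure α) (f : α → ℝ) :
    secondMoment μ f = eLpNorm f 2 μ ^ 2 := by
  rw [eLpNorm_eq_lintegral_rpow_enorm_toReal two_ne_zero ENNReal.ofNat_ne_top,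
    ← ENNReal.rpow_natCast, ← ENNReal.rpow_mul, secondMoment]
  simp only [ENNReal.toReal_ofNat, Nat.cast_ofNat, ENNReal.rpow_ofNat]
  norm_num
  refine lintegral_congr fun a => ?_
  rw [← sq_abs, ENNReal.ofReal_pow (abs_nonneg _), Real.enorm_eq_ofReal_abs]

lemma memLp_two_iff_secondMoment {μ : Measure α} {f : α → ℝ} (hf : AEStronglyMeasurable f μ) :
    MemLp f 2 μ ↔ secondMoment μ f < ∞ := by
  rw [secondMoment_eq_eLpNorm_sq]
  simp [MemLp, hf]

lemma secondMoment_mono {μ : Measure α} {f g : α → ℝ} (h : ∀ a, |f a| ≤ |g a|) :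
    secondMoment μ f ≤ secondMoment μ g :=
  lintegral_mono fun a => ENNReal.ofReal_le_ofReal (sq_le_sq.2 (h a))

lemma secondMoment_add_le {μ : Measure α} {f : α → ℝ} (hf : Measurable f) (g : α → ℝ) :
    secondMoment μ (fun a => f a + g a) ≤ 2 * secondMoment μ f + 2 * secondMoment μ g := by
  have hfm : Measurable fun a => ENNReal.ofReal (f a ^ 2) :=
    ENNReal.measurable_ofReal.comp (hf.pow_const 2)
  calc secondMoment μ (fun a => f a + g a)
      ≤ ∫⁻ a, 2 * (ENNReal.ofReal (f a ^ 2) + ENNReal.ofReal (g a ^ 2)) ∂μ := by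
        refine lintegral_mono fun a => ?_
        rw [← ENNReal.ofReal_add (sq_nonneg _) (sq_nonneg _),
          show (2 : ℝ≥0∞) = ENNReal.ofReal 2 by simp, ← ENNReal.ofReal_mul zero_le_two]
        exact ENNReal.ofReal_le_ofReal (by nlinarith [sq_nonneg (f a - g a)])
    _ = _ := by
        rw [lintegral_const_mul' _ _ ENNReal.ofNat_ne_top, lintegral_add_left hfm, mul_add]
        rfl

lemma secondMoment_comp {β : Type*} [MeasurableSpace β] {μ : Measure α} {μ' : Measure β}
    {g : α → β} (hg : MeasurePreserving g μ μ') {f : β → ℝ} (hf : Measurable f) :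
    secondMoment μ (fun a => f (g a)) = secondMoment μ' f :=
  hg.lintegral_comp (ENNReal.measurable_ofReal.comp (hf.pow_const 2))

end SecondMoment

/-! ### Kernel averages of a function of the observations -/

section KernelAverage

variable {𝒟 𝒮 : Type*} {M : ℕ} {R : 𝒟 → 𝒮 → E M}

/-- The kernel average of a function `f` of the observations, at the prediction for the test
point; it may depend on the data `D` that determine the predictions. -/
noncomputable def kernelAverage (k : E M → ℝ) (R : 𝒟 → 𝒮 → E M) {ι : Type} [Fintype ι]
    [DecidableEq ι] (i₀ : ι) (f : 𝒟 × 𝒮 → ℝ) (q : 𝒟 × (ι → 𝒮)) : ℝ :=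
  ∑ j, nbrWeight k (R q.1 ∘ q.2) i₀ j * f (q.1, q.2 j)

lemma kernelAverage_add (k : E M → ℝ) {ι : Type} [Fintype ι] [DecidableEq ι] (i₀ : ι)
    (f g : 𝒟 × 𝒮 → ℝ) (q : 𝒟 × (ι → 𝒮)) :
    kernelAverage k R i₀ (fun x => f x + g x) q =
      kernelAverage k R i₀ f q + kernelAverage k R i₀ g q := by
  simp only [kernelAverage, mul_add, Finset.sum_add_distrib]

lemma abs_kernelAverage_le {k : E M → ℝ} (hk : ∀ x, 0 ≤ k x) {ι : Type} [Fintype ι]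
    [DecidableEq ι] (i₀ : ι) (f : 𝒟 × 𝒮 → ℝ) (q : 𝒟 × (ι → 𝒮)) :
    |kernelAverage k R i₀ f q| ≤ kernelAverage k R i₀ (fun x => |f x|) q := by
  refine (Finset.abs_sum_le_sum_abs _ _).trans_eq (Finset.sum_congr rfl fun j _ => ?_)
  rw [abs_mul, abs_of_nonneg (nbrWeight_nonneg hk _ _ _)]

end KernelAverage

section ConditionalSample

variable {𝒟 𝒮 : Type*} [MeasurableSpace 𝒟] [MeasurableSpace 𝒮]
  (π : Measure 𝒟) (ν : Measure 𝒮) [IsProbabilityMeasure ν]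
  {M : ℕ} {K : E M → ℝ} {R : 𝒟 → 𝒮 → E M}

lemma measurable_nbrWeight_sample (hR : Measurable fun q : 𝒟 × 𝒮 => R q.1 q.2)
    {k : E M → ℝ} (hk : Measurable k) {ι : Type} [Fintype ι] [DecidableEq ι] (i j : ι) :
    Measurable fun q : 𝒟 × (ι → 𝒮) => nbrWeight k (R q.1 ∘ q.2) i j :=
  measurable_nbrWeight hk (fun l => hR.comp
    (measurable_fst.prodMk ((measurable_pi_apply l).comp measurable_snd))) i j

lemma measurable_kernelAverage (hR : Measurable fun q : 𝒟 × 𝒮 => R q.1 q.2)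
    {k : E M → ℝ} (hk : Measurable k) {ι : Type} [Fintype ι] [DecidableEq ι] (i₀ : ι)
    {f : 𝒟 × 𝒮 → ℝ} (hf : Measurable f) :
    Measurable (kernelAverage k R i₀ f : 𝒟 × (ι → 𝒮) → ℝ) :=
  Finset.measurable_fun_sum _ fun j _ => (measurable_nbrWeight_sample hR hk i₀ j).mul
    (hf.comp (measurable_fst.prodMk ((measurable_pi_apply j).comp measurable_snd)))

/-- The second moment of the kernel average of `|f|` is controlled by that of `f`, uniformly in the
bandwidth, the sample size and the predictions. -/
lemma IsRegularKernel.exists_secondMoment_kernelAverage_le (hK : IsRegularKernel K)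
    (hR : Measurable fun q : 𝒟 × 𝒮 => R q.1 q.2) :
    ∃ C : ℝ, 0 ≤ C ∧ ∀ h : ℝ, 0 < h → ∀ {ι : Type} [Fintype ι] [DecidableEq ι] (i₀ : ι)
      (f : 𝒟 × 𝒮 → ℝ), Measurable f →
      secondMoment (π.prod (Measure.pi fun _ : ι => ν))
        (kernelAverage (scaled K h) R i₀ fun x => |f x|) ≤
        ENNReal.ofReal C * secondMoment (π.prod ν) f := by
  obtain ⟨C, hC, hbound⟩ := hK.exists_lintegral_average_sq_le
  refine ⟨C, hC, fun h hh ι _ _ i₀ f hf => ?_⟩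
  have hm := measurable_kernelAverage (ι := ι) hR (hK.measurable_scaled h) i₀ hf.abs
  have hm2 : Measurable fun q : 𝒟 × (ι → 𝒮) =>
      ENNReal.ofReal (kernelAverage (scaled K h) R i₀ (fun x => |f x|) q ^ 2) :=
    ENNReal.measurable_ofReal.comp (hm.pow_const 2)
  have hf2 : Measurable fun x => ENNReal.ofReal (f x ^ 2) :=
    ENNReal.measurable_ofReal.comp (hf.pow_const 2)
  rw [secondMoment, secondMoment, lintegral_prod _ hm2.aemeasurable,
    lintegral_prod _ hf2.aemeasurable, ← lintegral_const_mul' _ _ ENNReal.ofReal_ne_top]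
  refine lintegral_mono fun D => ?_
  exact hbound h hh i₀ ν (R D) (hR.comp measurable_prodMk_left) (fun s => f (D, s))
    (hf.comp measurable_prodMk_left)

variable [IsProbabilityMeasure π]

lemma measurePreserving_prod_eval {ι : Type} [Fintype ι] (j : ι) :
    MeasurePreserving (fun q : 𝒟 × (ι → 𝒮) => (q.1, q.2 j))
      (π.prod (Measure.pi fun _ => ν)) (π.prod ν) :=
  (MeasurePreserving.id π).prod (measurePreserving_eval (fun _ : ι => ν) j)

lemma measurePreserving_prod_update {ι : Type} [Fintype ι] [DecidableEq ι] (i : ι) :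
    MeasurePreserving (fun q : (ι → 𝒮) × (𝒟 × 𝒮) => (q.2.1, Function.update q.1 i q.2.2))
      ((Measure.pi fun _ => ν).prod (π.prod ν)) (π.prod (Measure.pi fun _ => ν)) := by
  have h1 := (measurePreserving_prodAssoc (Measure.pi fun _ : ι => ν) π ν).symm
  have h2 := (Measure.measurePreserving_swap (μ := Measure.pi fun _ : ι => ν) (ν := π)).prod
    (MeasurePreserving.id ν)
  have h3 := measurePreserving_prodAssoc π (Measure.pi fun _ : ι => ν) ν
  have h4 := (MeasurePreserving.id π).prod (measurePreserving_update ν i)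
  exact h4.comp (h3.comp (h2.comp h1))

/-- Dominated convergence with respect to the data `D`. -/
lemma tendsto_lintegral_prod_of_bounded {B : ℝ≥0∞} (hB : B ≠ ∞)
    {F : (ℓ : ℕ) → 𝒟 × (Option (Fin ℓ) → 𝒮) → ℝ≥0∞} (hF : ∀ ℓ, Measurable (F ℓ))
    (hFB : ∀ ℓ q, F ℓ q ≤ B)
    (hlim : ∀ D, Tendsto (fun ℓ => ∫⁻ w, F ℓ (D, w) ∂(Measure.pi fun _ => ν)) atTop (𝓝 0)) :
    Tendsto (fun ℓ => ∫⁻ q, F ℓ q ∂(π.prod (Measure.pi fun _ => ν))) atTop (𝓝 0) := by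
  have h1 : ∀ ℓ, ∫⁻ q, F ℓ q ∂(π.prod (Measure.pi fun _ => ν)) =
      ∫⁻ D, ∫⁻ w, F ℓ (D, w) ∂(Measure.pi fun _ => ν) ∂π :=
    fun ℓ => lintegral_prod _ (hF ℓ).aemeasurable
  simp_rw [h1]
  have := tendsto_lintegral_of_dominated_convergence (μ := π) (fun _ => B)
    (fun ℓ => (hF ℓ).lintegral_prod_right') (f := fun _ => 0)
    (fun ℓ => Eventually.of_forall fun D => (lintegral_mono fun w => hFB ℓ (D, w)).trans
      (by simp)) (by simpa using hB) (Eventually.of_forall hlim)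
  simpa using this

variable {h : ℕ → ℝ}

/-- A sequence of `[0, ∞]` tends to zero when it is at most an arbitrarily small bound plus a
vanishing sequence. -/
lemma tendsto_zero_of_le_add {B : ℝ → ℝ≥0∞} {C : ℝ≥0∞} (hC : C ≠ ∞)
    (hB : Tendsto B (𝓝[>] 0) (𝓝 0)) {u : ℕ → ℝ≥0∞} {v : ℝ → ℕ → ℝ≥0∞}
    (hv : ∀ ε, 0 < ε → Tendsto (v ε) atTop (𝓝 0))
    (huv : ∀ ε, 0 < ε → ∀ ℓ, u ℓ ≤ B ε + C * v ε ℓ) : Tendsto u atTop (𝓝 0) := by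
  refine ENNReal.tendsto_nhds_zero.2 fun η hη => ?_
  have hη2 : 0 < η / 2 := ENNReal.half_pos hη.ne'
  obtain ⟨ε, hεB, hε⟩ := ((ENNReal.tendsto_nhds_zero.1 hB _ hη2).and
    self_mem_nhdsWithin).exists
  have h1 := ENNReal.Tendsto.const_mul (hv ε hε) (Or.inr hC)
  rw [mul_zero] at h1
  filter_upwards [ENNReal.tendsto_nhds_zero.1 h1 _ hη2] with ℓ hℓ
  calc u ℓ ≤ B ε + C * v ε ℓ := huv ε hε ℓ
    _ ≤ η / 2 + η / 2 := add_le_add hεB hℓ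
    _ = η := ENNReal.add_halves η

/-- The mean of the sum of the squared weights vanishes: no single observation dominates. -/
lemma IsRegularKernel.tendsto_lintegral_sum_sq (hK : IsRegularKernel K)
    (hpos : ∀ ℓ, 0 < h ℓ) (hzero : Tendsto h atTop (𝓝 0))
    (hinf : Tendsto (fun ℓ : ℕ => h ℓ ^ M * (ℓ : ℝ)) atTop atTop)
    (hR : Measurable fun q : 𝒟 × 𝒮 => R q.1 q.2) (hRb : ∀ D, ∃ C, ∀ s, ‖R D s‖ ≤ C) :
    Tendsto (fun ℓ : ℕ => ∫⁻ q, ENNReal.ofReal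
      (∑ j, nbrWeight (scaled K (h ℓ)) (R q.1 ∘ q.2) (none : Option (Fin ℓ)) j ^ 2)
      ∂(π.prod (Measure.pi fun _ => ν))) atTop (𝓝 0) := by
  have hle1 : ∀ {ι : Type} [Fintype ι] [DecidableEq ι] (h : ℝ) (i : ι) (z : ι → E M),
      ∑ j, nbrWeight (scaled K h) z i j ^ 2 ≤ 1 := by
    intro ι _ _ h i z
    refine (Finset.sum_le_sum fun j _ => ?_).trans (sum_nbrWeight_le_one (scaled K h) z i)
    have h0 := nbrWeight_nonneg (hK.scaled_nonneg h) z i j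
    have h1 := abs_nbrWeight_le_one (hK.scaled_nonneg h) z i j
    rw [abs_of_nonneg h0] at h1
    nlinarith
  refine tendsto_lintegral_prod_of_bounded π ν ENNReal.one_ne_top (fun ℓ => ?_)
    (fun ℓ q => ?_) fun D => ?_
  · exact ENNReal.measurable_ofReal.comp (Finset.measurable_fun_sum _ fun j _ =>
      (measurable_nbrWeight_sample hR (hK.measurable_scaled _) _ j).pow_const 2)
  · exact ENNReal.ofReal_le_one.2 (hle1 _ _ _)
  obtain ⟨C, hC⟩ := hRb D
  have hRD : Measurable (R D) := hR.comp measurable_prodMk_left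
  refine tendsto_zero_of_le_add (B := fun ε => ENNReal.ofReal ε) ENNReal.one_ne_top ?_
    (fun ε hε => hK.tendsto_measure_not_isGood hpos hzero hinf ν hRD hC hε one_pos)
    fun ε hε ℓ => ?_
  · have := (ENNReal.continuous_ofReal.tendsto 0).mono_left
      (nhdsWithin_le_nhds (s := Set.Ioi (0 : ℝ)))
    simpa using this
  have hms : MeasurableSet
      {w : Option (Fin ℓ) → 𝒮 | ¬ IsGood (scaled K (h ℓ)) ε 1 none (R D ∘ w)} :=
    (measurableSet_isGood (hK.measurable_scaled _) ε 1 none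
      (fun i => hRD.comp (measurable_pi_apply i))).compl
  rw [one_mul, ← lintegral_indicator_one hms]
  have hconst : ENNReal.ofReal ε =
      ∫⁻ _, ENNReal.ofReal ε ∂(Measure.pi fun _ : Option (Fin ℓ) => ν) := by simp
  rw [hconst, ← lintegral_add_left measurable_const]
  refine lintegral_mono fun w => ?_
  by_cases hw : IsGood (scaled K (h ℓ)) ε 1 none (R D ∘ w)
  · exact le_add_right (ENNReal.ofReal_le_ofReal hw.2.1)
  · refine le_add_left ?_
    rw [Set.indicator_of_mem hw]
    exact ENNReal.ofReal_le_one.2 (hle1 _ _ _)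

/-- Consistency of the kernel average for a bounded continuous function of the prediction. -/
lemma IsRegularKernel.tendsto_secondMoment_of_continuous (hK : IsRegularKernel K)
    (hpos : ∀ ℓ, 0 < h ℓ) (hzero : Tendsto h atTop (𝓝 0))
    (hinf : Tendsto (fun ℓ : ℕ => h ℓ ^ M * (ℓ : ℝ)) atTop atTop)
    (hR : Measurable fun q : 𝒟 × 𝒮 => R q.1 q.2) (hRb : ∀ D, ∃ C, ∀ s, ‖R D s‖ ≤ C)
    {c : 𝒟 × E M → ℝ} (hc : Measurable c) (hcont : ∀ D, Continuous fun y => c (D, y))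
    {B : ℝ} (hB : 0 ≤ B) (hcB : ∀ x, |c x| ≤ B) :
    Tendsto (fun ℓ : ℕ => secondMoment (π.prod (Measure.pi fun _ => ν)) fun q =>
      kernelAverage (scaled K (h ℓ)) R (none : Option (Fin ℓ)) (fun x => c (x.1, R x.1 x.2)) q -
        c (q.1, R q.1 (q.2 none))) atTop (𝓝 0) := by
  have hcR : Measurable fun x : 𝒟 × 𝒮 => c (x.1, R x.1 x.2) := hc.comp (measurable_fst.prodMk hR)
  have hbd : ∀ (ℓ : ℕ) (q : 𝒟 × (Option (Fin ℓ) → 𝒮)),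
      (kernelAverage (scaled K (h ℓ)) R none (fun x => c (x.1, R x.1 x.2)) q -
        c (q.1, R q.1 (q.2 none))) ^ 2 ≤ (2 * B) ^ 2 := by
    intro ℓ q
    refine sq_le_sq.2 ?_
    rw [abs_of_nonneg (by positivity : 0 ≤ 2 * B)]
    have h1 : kernelAverage (scaled K (h ℓ)) R none (fun x => |c (x.1, R x.1 x.2)|) q ≤ B := by
      calc _ ≤ ∑ j, nbrWeight (scaled K (h ℓ)) (R q.1 ∘ q.2) none j * B :=
            Finset.sum_le_sum fun j _ => mul_le_mul_of_nonneg_left (hcB _)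
              (nbrWeight_nonneg (hK.scaled_nonneg _) _ _ _)
        _ ≤ B := by
            rw [← Finset.sum_mul]
            exact mul_le_of_le_one_left hB (sum_nbrWeight_le_one _ _ _)
    have h2 := abs_kernelAverage_le (R := R) (hK.scaled_nonneg (h ℓ)) none
      (fun x : 𝒟 × 𝒮 => c (x.1, R x.1 x.2)) q
    have h3 := hcB (q.1, R q.1 (q.2 none))
    have h4 := abs_sub (kernelAverage (scaled K (h ℓ)) R none (fun x => c (x.1, R x.1 x.2)) q)
      (c (q.1, R q.1 (q.2 none)))
    linarith
  refine tendsto_lintegral_prod_of_bounded π ν (B := ENNReal.ofReal ((2 * B) ^ 2))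
    ENNReal.ofReal_ne_top (fun ℓ => ?_) (fun ℓ q => ENNReal.ofReal_le_ofReal (hbd ℓ q)) fun D => ?_
  · refine ENNReal.measurable_ofReal.comp (Measurable.pow_const (Measurable.sub ?_ ?_) 2)
    · exact measurable_kernelAverage hR (hK.measurable_scaled _) _ hcR
    · exact hcR.comp (measurePreserving_prod_eval π ν none).measurable
  obtain ⟨C, hC⟩ := hRb D
  have hRD : Measurable (R D) := hR.comp measurable_prodMk_left
  have huc : UniformContinuousOn (fun y => c (D, y)) (Metric.closedBall 0 C) :=
    (isCompact_closedBall _ _).uniformContinuousOn_of_continuous (hcont D).continuousOn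
  rw [Metric.uniformContinuousOn_iff] at huc
  choose! δ hδ hδc using huc
  refine tendsto_zero_of_le_add (B := fun ε => ENNReal.ofReal (((1 + 2 * B) * ε) ^ 2))
    (ENNReal.ofReal_ne_top (r := (2 * B) ^ 2)) ?_
    (fun ε hε => hK.tendsto_measure_not_isGood hpos hzero hinf ν hRD hC hε (hδ ε hε))
    fun ε hε ℓ => ?_
  · have hcts : Continuous fun ε : ℝ => ENNReal.ofReal (((1 + 2 * B) * ε) ^ 2) :=
      ENNReal.continuous_ofReal.comp (by fun_prop)
    have := (hcts.tendsto 0).mono_left (nhdsWithin_le_nhds (s := Set.Ioi (0 : ℝ)))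
    simpa using this
  have hms : MeasurableSet
      {w : Option (Fin ℓ) → 𝒮 | ¬ IsGood (scaled K (h ℓ)) ε (δ ε) none (R D ∘ w)} :=
    (measurableSet_isGood (hK.measurable_scaled _) ε (δ ε) none
      (fun i => hRD.comp (measurable_pi_apply i))).compl
  rw [← lintegral_indicator_one hms, ← lintegral_const_mul' _ _ ENNReal.ofReal_ne_top]
  have hconst : ENNReal.ofReal (((1 + 2 * B) * ε) ^ 2) =
      ∫⁻ _, ENNReal.ofReal (((1 + 2 * B) * ε) ^ 2)
        ∂(Measure.pi fun _ : Option (Fin ℓ) => ν) := by simp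
  rw [hconst, ← lintegral_add_left measurable_const]
  refine lintegral_mono fun w => ?_
  by_cases hw : IsGood (scaled K (h ℓ)) ε (δ ε) none (R D ∘ w)
  · refine le_add_right (ENNReal.ofReal_le_ofReal (sq_le_sq.2 ?_))
    rw [abs_of_nonneg (by positivity : 0 ≤ (1 + 2 * B) * ε)]
    obtain ⟨hw1, -, hw3⟩ := hw
    set W := nbrWeight (scaled K (h ℓ)) (R D ∘ w) none with hW
    have hW0 : ∀ j, 0 ≤ W j := nbrWeight_nonneg (hK.scaled_nonneg _) _ _
    have hrw : kernelAverage (scaled K (h ℓ)) R none (fun x => c (x.1, R x.1 x.2)) (D, w) -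
        c (D, R D (w none)) = ∑ j, W j * (c (D, R D (w j)) - c (D, R D (w none))) := by
      simp only [mul_sub, Finset.sum_sub_distrib, ← Finset.sum_mul, hw1, one_mul]
      rfl
    calc |kernelAverage (scaled K (h ℓ)) R none (fun x => c (x.1, R x.1 x.2)) (D, w) -
          c (D, R D (w none))|
        ≤ ∑ j, W j * |c (D, R D (w j)) - c (D, R D (w none))| := by
          rw [hrw]
          refine (Finset.abs_sum_le_sum_abs _ _).trans_eq (Finset.sum_congr rfl fun j _ => ?_)
          rw [abs_mul, abs_of_nonneg (hW0 j)]
      _ ≤ ∑ j, (W j * ε + 2 * B * if δ ε ≤ ‖(R D ∘ w) j - (R D ∘ w) none‖ then W j else 0) := by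
          refine Finset.sum_le_sum fun j _ => ?_
          split_ifs with hd
          · have h1 := hcB (D, R D (w j))
            have h2 := hcB (D, R D (w none))
            have h3 := abs_sub (c (D, R D (w j))) (c (D, R D (w none)))
            have h4 : |c (D, R D (w j)) - c (D, R D (w none))| ≤ 2 * B := by linarith
            have := mul_le_mul_of_nonneg_left h4 (hW0 j)
            have := mul_nonneg (hW0 j) hε.le
            linarith
          · have h1 := hδc ε hε (R D (w j)) (by simpa using hC _) (R D (w none))
              (by simpa using hC _) (by rw [dist_eq_norm]; exact not_le.1 hd)
            rw [Real.dist_eq] at h1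
            have := mul_le_mul_of_nonneg_left h1.le (hW0 j)
            linarith
      _ ≤ (1 + 2 * B) * ε := by
          rw [Finset.sum_add_distrib, ← Finset.sum_mul, hw1, ← Finset.mul_sum]
          have := mul_le_mul_of_nonneg_left hw3 (by positivity : 0 ≤ 2 * B)
          linarith
  · refine le_add_left ?_
    rw [Set.indicator_of_mem hw, Pi.one_apply, mul_one]
    exact ENNReal.ofReal_le_ofReal (hbd ℓ (D, w))

end ConditionalSample

/-! ### Consistency of the kernel averages -/

section Consistency

variable {𝒟 𝒮 : Type*} [MeasurableSpace 𝒟] [MeasurableSpace 𝒮]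
  (π : Measure 𝒟) [IsProbabilityMeasure π] (ν : Measure 𝒮) [IsProbabilityMeasure ν]
  {M : ℕ} {K : E M → ℝ} {R : 𝒟 → 𝒮 → E M} {h : ℕ → ℝ}

/-- Consistency of the kernel average for a square-integrable function of the data and the
prediction, by density of the bounded continuous functions in `L²`. -/
lemma IsRegularKernel.tendsto_secondMoment_of_memLp [MetricSpace 𝒟] [SecondCountableTopology 𝒟]
    [BorelSpace 𝒟] (hK : IsRegularKernel K)
    (hpos : ∀ ℓ, 0 < h ℓ) (hzero : Tendsto h atTop (𝓝 0))
    (hinf : Tendsto (fun ℓ : ℕ => h ℓ ^ M * (ℓ : ℝ)) atTop atTop)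
    (hR : Measurable fun q : 𝒟 × 𝒮 => R q.1 q.2) (hRb : ∀ D, ∃ C, ∀ s, ‖R D s‖ ≤ C)
    {c : 𝒟 × E M → ℝ} (hc : Measurable c)
    (hc2 : MemLp (fun x : 𝒟 × 𝒮 => c (x.1, R x.1 x.2)) 2 (π.prod ν)) :
    Tendsto (fun ℓ : ℕ => secondMoment (π.prod (Measure.pi fun _ => ν)) fun q =>
      kernelAverage (scaled K (h ℓ)) R (none : Option (Fin ℓ)) (fun x => c (x.1, R x.1 x.2)) q -
        c (q.1, R q.1 (q.2 none))) atTop (𝓝 0) := by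
  set Φ : 𝒟 × 𝒮 → 𝒟 × E M := fun x => (x.1, R x.1 x.2) with hΦ
  have hΦm : Measurable Φ := measurable_fst.prodMk hR
  have hΦp : MeasurePreserving Φ (π.prod ν) ((π.prod ν).map Φ) := hΦm.measurePreserving _
  have : IsProbabilityMeasure ((π.prod ν).map Φ) :=
    Measure.isProbabilityMeasure_map hΦm.aemeasurable
  have hcL : MemLp c 2 ((π.prod ν).map Φ) :=
    (memLp_map_measure_iff hc.aestronglyMeasurable hΦm.aemeasurable).2 hc2
  obtain ⟨C, hC, hbound⟩ := hK.exists_secondMoment_kernelAverage_le π ν hR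
  have happrox : ∀ ε : ℝ, 0 < ε → ∃ g : BoundedContinuousFunction (𝒟 × E M) ℝ,
      secondMoment ((π.prod ν).map Φ) (fun x => c x - g x) ≤ ENNReal.ofReal ε ^ 2 := by
    intro ε hε
    obtain ⟨g, hg, -⟩ := hcL.exists_boundedContinuous_eLpNorm_sub_le ENNReal.ofNat_ne_top
      (ENNReal.ofReal_pos.2 hε).ne'
    refine ⟨g, ?_⟩
    rw [secondMoment_eq_eLpNorm_sq]
    exact pow_le_pow_left' hg 2
  choose! g hg using happrox
  refine tendsto_zero_of_le_add (C := 4)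
    (B := fun ε => (4 * ENNReal.ofReal C + 2) * ENNReal.ofReal ε ^ 2) (by simp) ?_
    (v := fun ε ℓ => secondMoment (π.prod (Measure.pi fun _ => ν)) fun q =>
      kernelAverage (scaled K (h ℓ)) R (none : Option (Fin ℓ)) (fun x => g ε (x.1, R x.1 x.2)) q -
        g ε (q.1, R q.1 (q.2 none)))
    (fun ε hε => hK.tendsto_secondMoment_of_continuous π ν hpos hzero hinf hR hRb
      (g ε).continuous.measurable (fun D => (g ε).continuous.comp (by fun_prop)) (norm_nonneg (g ε))
      fun x => (g ε).norm_coe_le_norm x) fun ε hε ℓ => ?_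
  · have h1 : Tendsto (fun ε : ℝ => ENNReal.ofReal ε ^ 2) (𝓝[>] 0) (𝓝 0) := by
      have hcts : Continuous fun ε : ℝ => ENNReal.ofReal ε ^ 2 :=
        (ENNReal.continuous_pow 2).comp ENNReal.continuous_ofReal
      have := (hcts.tendsto 0).mono_left (nhdsWithin_le_nhds (s := Set.Ioi (0 : ℝ)))
      simpa using this
    have h2 := ENNReal.Tendsto.const_mul h1 (a := 4 * ENNReal.ofReal C + 2)
      (Or.inr (by finiteness))
    simpa using h2
  -- the error for `c` is the error for `g ε` plus two terms controlled by `c - g ε`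
  set G := g ε with hG
  have hGm : Measurable G := G.continuous.measurable
  set e : 𝒟 × 𝒮 → ℝ := fun x => c (Φ x) - G (Φ x) with he
  have hem : Measurable e := (hc.comp hΦm).sub (hGm.comp hΦm)
  have he2 : secondMoment (π.prod ν) e ≤ ENNReal.ofReal ε ^ 2 :=
    (secondMoment_comp hΦp (hc.sub hGm)).trans_le (hg ε hε)
  have hev := measurePreserving_prod_eval π ν (none : Option (Fin ℓ))
  have hk := hK.measurable_scaled (h ℓ)
  set A : 𝒟 × (Option (Fin ℓ) → 𝒮) → ℝ := fun q =>
    kernelAverage (scaled K (h ℓ)) R none (fun x => G (Φ x)) q - G (Φ (q.1, q.2 none)) with hA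
  have hAm : Measurable A := (measurable_kernelAverage hR hk none (hGm.comp hΦm)).sub
    ((hGm.comp hΦm).comp hev.measurable)
  set T : 𝒟 × (Option (Fin ℓ) → 𝒮) → ℝ := kernelAverage (scaled K (h ℓ)) R none e with hT
  have hTm : Measurable T := measurable_kernelAverage hR hk none hem
  have hT2 : secondMoment (π.prod (Measure.pi fun _ => ν)) T ≤
      ENNReal.ofReal C * ENNReal.ofReal ε ^ 2 :=
    calc _ ≤ secondMoment (π.prod (Measure.pi fun _ => ν))
          (kernelAverage (scaled K (h ℓ)) R none fun x => |e x|) :=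
          secondMoment_mono fun q =>
            (abs_kernelAverage_le (hK.scaled_nonneg _) none e q).trans (le_abs_self _)
      _ ≤ _ := (hbound (h ℓ) (hpos ℓ) none e hem).trans (by gcongr)
  have hE2 : secondMoment (π.prod (Measure.pi fun _ : Option (Fin ℓ) => ν))
      (fun q => -e (q.1, q.2 none)) ≤ ENNReal.ofReal ε ^ 2 := by
    simp only [secondMoment, neg_sq]
    exact (secondMoment_comp hev hem).trans_le he2
  have hsplit : (fun q : 𝒟 × (Option (Fin ℓ) → 𝒮) =>
      kernelAverage (scaled K (h ℓ)) R none (fun x => c (Φ x)) q - c (Φ (q.1, q.2 none))) =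
      fun q => (A q + T q) + -e (q.1, q.2 none) := by
    funext q
    have hadd := kernelAverage_add (R := R) (scaled K (h ℓ)) none (fun x => G (Φ x)) e q
    have hce : (fun x => G (Φ x) + e x) = fun x => c (Φ x) := by
      funext x; simp only [he]; ring
    rw [hce] at hadd
    rw [hadd]
    simp only [hA, hT, he]
    ring
  change secondMoment _ (fun q : 𝒟 × (Option (Fin ℓ) → 𝒮) =>
      kernelAverage (scaled K (h ℓ)) R none (fun x => c (Φ x)) q - c (Φ (q.1, q.2 none))) ≤
    _ + 4 * secondMoment _ A
  rw [hsplit]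
  calc _ ≤ 2 * secondMoment _ (fun q => A q + T q) + 2 * secondMoment _ _ :=
        secondMoment_add_le (hAm.add hTm) _
    _ ≤ 2 * (2 * secondMoment _ A + 2 * (ENNReal.ofReal C * ENNReal.ofReal ε ^ 2)) +
        2 * ENNReal.ofReal ε ^ 2 := by
        gcongr
        exact (secondMoment_add_le hAm _).trans (by gcongr)
    _ = _ := by ring

/-- Terms with different indices of the kernel average of a function that is orthogonal to the
functions of the data and the prediction are uncorrelated: the weights depend on an observation
through its prediction only, so integrating out that observation gives zero. -/
lemma integral_cross_eq_zero (hR : Measurable fun q : 𝒟 × 𝒮 => R q.1 q.2)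
    {k : E M → ℝ} (hk : Measurable k) {ι : Type} [Fintype ι] [DecidableEq ι] (i₀ : ι)
    {ψ : 𝒟 × 𝒮 → ℝ} (hψ : Measurable ψ)
    (hort : ∀ G : 𝒟 × E M → ℝ, Measurable G → ∫ x, G (x.1, R x.1 x.2) * ψ x ∂(π.prod ν) = 0)
    {i j : ι} (hij : i ≠ j)
    (hint : Integrable (fun q : 𝒟 × (ι → 𝒮) =>
      (nbrWeight k (R q.1 ∘ q.2) i₀ i * ψ (q.1, q.2 i)) *
        (nbrWeight k (R q.1 ∘ q.2) i₀ j * ψ (q.1, q.2 j))) (π.prod (Measure.pi fun _ => ν))) :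
    ∫ q : 𝒟 × (ι → 𝒮), (nbrWeight k (R q.1 ∘ q.2) i₀ i * ψ (q.1, q.2 i)) *
      (nbrWeight k (R q.1 ∘ q.2) i₀ j * ψ (q.1, q.2 j)) ∂(π.prod (Measure.pi fun _ => ν)) = 0 := by
  rcases eq_or_ne i i₀ with rfl | hi
  · simp [nbrWeight]
  have hU := measurePreserving_prod_update π ν i
  have hint' := hU.integrable_comp_of_integrable hint
  rw [← hU.map_eq, integral_map hU.measurable.aemeasurable (by rw [hU.map_eq]; exact hint.1)]
  rw [Function.comp_def] at hint'
  rw [integral_prod _ hint']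
  refine integral_eq_zero_of_ae (Eventually.of_forall fun w => ?_)
  have hz : Measurable fun y : 𝒟 × E M => fun l : ι =>
      Function.update (fun l => R y.1 (w l)) i y.2 l := by
    refine measurable_pi_iff.2 fun l => ?_
    rcases eq_or_ne l i with rfl | hl
    · simpa using measurable_snd
    · simp only [Function.update_of_ne hl]
      exact hR.comp (measurable_fst.prodMk measurable_const)
  have hz' := fun l => (measurable_pi_apply l).comp hz
  refine Eq.trans (integral_congr_ae (Eventually.of_forall fun x => ?_))
    (hort (fun y => nbrWeight k (Function.update (fun l => R y.1 (w l)) i y.2) i₀ i *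
      (nbrWeight k (Function.update (fun l => R y.1 (w l)) i y.2) i₀ j * ψ (y.1, w j)))
      ((measurable_nbrWeight hk hz' i₀ i).mul ((measurable_nbrWeight hk hz' i₀ j).mul
        (hψ.comp (measurable_fst.prodMk measurable_const)))))
  simp only [Function.comp_update, Function.update_self, Function.update_of_ne hij.symm]
  simp only [Function.comp_def]
  ring

/-- The kernel average of a square-integrable function that is orthogonal to the functions of the
data and the prediction vanishes asymptotically: its variance is the sum of the variances of its
terms. -/
lemma IsRegularKernel.tendsto_secondMoment_of_orthogonal (hK : IsRegularKernel K)
    (hpos : ∀ ℓ, 0 < h ℓ) (hzero : Tendsto h atTop (𝓝 0))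
    (hinf : Tendsto (fun ℓ : ℕ => h ℓ ^ M * (ℓ : ℝ)) atTop atTop)
    (hR : Measurable fun q : 𝒟 × 𝒮 => R q.1 q.2) (hRb : ∀ D, ∃ C, ∀ s, ‖R D s‖ ≤ C)
    {ψ : 𝒟 × 𝒮 → ℝ} (hψ : Measurable ψ) (hψ2 : MemLp ψ 2 (π.prod ν))
    (hort : ∀ G : 𝒟 × E M → ℝ, Measurable G → ∫ x, G (x.1, R x.1 x.2) * ψ x ∂(π.prod ν) = 0) :
    Tendsto (fun ℓ : ℕ => secondMoment (π.prod (Measure.pi fun _ => ν))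
      (kernelAverage (scaled K (h ℓ)) R (none : Option (Fin ℓ)) ψ)) atTop (𝓝 0) := by
  have hdiag : ∀ ℓ : ℕ, secondMoment (π.prod (Measure.pi fun _ => ν))
      (kernelAverage (scaled K (h ℓ)) R (none : Option (Fin ℓ)) ψ) =
      ∫⁻ q, ENNReal.ofReal (∑ j, (nbrWeight (scaled K (h ℓ)) (R q.1 ∘ q.2)
        (none : Option (Fin ℓ)) j * ψ (q.1, q.2 j)) ^ 2) ∂(π.prod (Measure.pi fun _ => ν)) := by
    intro ℓ
    set a : Option (Fin ℓ) → 𝒟 × (Option (Fin ℓ) → 𝒮) → ℝ := fun j q =>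
      nbrWeight (scaled K (h ℓ)) (R q.1 ∘ q.2) none j * ψ (q.1, q.2 j) with ha
    have haL : ∀ j, MemLp (a j) 2 (π.prod (Measure.pi fun _ => ν)) := by
      intro j
      have hev := measurePreserving_prod_eval π ν j
      have hψj : MemLp (fun q : 𝒟 × (Option (Fin ℓ) → 𝒮) => ψ (q.1, q.2 j)) 2
          (π.prod (Measure.pi fun _ => ν)) := hψ2.comp_measurePreserving hev
      refine hψj.mono (((measurable_nbrWeight_sample hR (hK.measurable_scaled _) none j).mul
        (hψ.comp hev.measurable)).aestronglyMeasurable) (Eventually.of_forall fun q => ?_)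
      rw [norm_mul]
      exact mul_le_of_le_one_left (norm_nonneg _)
        (abs_nbrWeight_le_one (hK.scaled_nonneg _) _ _ _)
    have haa : ∀ i j, Integrable (fun q => a i q * a j q) (π.prod (Measure.pi fun _ => ν)) :=
      fun i j => (haL i).integrable_mul (haL j)
    have hsq : ∀ q, kernelAverage (scaled K (h ℓ)) R none ψ q ^ 2 = ∑ i, ∑ j, a i q * a j q := by
      intro q
      rw [sq, ← Finset.sum_mul_sum]
      rfl
    rw [secondMoment]
    have hsum : ∀ q : 𝒟 × (Option (Fin ℓ) → 𝒮),
        ∑ j, (nbrWeight (scaled K (h ℓ)) (R q.1 ∘ q.2) (none : Option (Fin ℓ)) j *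
          ψ (q.1, q.2 j)) ^ 2 = ∑ j, a j q * a j q := fun q => by simp only [sq, ha]
    simp_rw [hsum, hsq]
    rw [← ofReal_integral_eq_lintegral_ofReal, ← ofReal_integral_eq_lintegral_ofReal]
    · congr 1
      rw [integral_finsetSum _ fun i _ => integrable_finsetSum _ fun j _ => haa i j,
        integral_finsetSum _ fun j _ => haa j j]
      refine Finset.sum_congr rfl fun i _ => ?_
      rw [integral_finsetSum _ fun j _ => haa i j]
      refine Finset.sum_eq_single i (fun j _ hji => ?_) (fun hi => absurd (Finset.mem_univ i) hi)
      exact integral_cross_eq_zero π ν hR (hK.measurable_scaled _) none hψ hort hji.symm (haa i j)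
    · exact integrable_finsetSum _ fun j _ => haa j j
    · exact Eventually.of_forall fun q => Finset.sum_nonneg fun j _ => mul_self_nonneg _
    · exact integrable_finsetSum _ fun i _ => integrable_finsetSum _ fun j _ => haa i j
    · exact Eventually.of_forall fun q => (sq_nonneg _).trans_eq (hsq q)
  obtain ⟨C, hC, hbound⟩ := hK.exists_secondMoment_kernelAverage_le π ν hR
  -- truncation at level `n`
  set ψt : ℕ → 𝒟 × 𝒮 → ℝ := fun n => {x | (n : ℝ) < |ψ x|}.indicator ψ with hψt
  have hψtm : ∀ n, Measurable (ψt n) := fun n =>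
    hψ.indicator (measurableSet_lt measurable_const hψ.abs)
  have htail : Tendsto (fun n => secondMoment (π.prod ν) (ψt n)) atTop (𝓝 0) := by
    have := tendsto_lintegral_of_dominated_convergence (μ := π.prod ν)
      (F := fun n x => ENNReal.ofReal (ψt n x ^ 2)) (f := fun _ => 0)
      (fun x => ENNReal.ofReal (ψ x ^ 2))
      (fun n => ENNReal.measurable_ofReal.comp ((hψtm n).pow_const 2))
      (fun n => Eventually.of_forall fun x => ENNReal.ofReal_le_ofReal ?_)
      ((memLp_two_iff_secondMoment hψ2.1).1 hψ2).ne (Eventually.of_forall fun x => ?_)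
    · simpa [secondMoment] using this
    · simp only [hψt, Set.indicator_apply]
      split_ifs
      · exact le_rfl
      · simpa using sq_nonneg (ψ x)
    · obtain ⟨n₀, hn₀⟩ := exists_nat_ge |ψ x|
      refine tendsto_const_nhds.congr' ?_
      filter_upwards [eventually_ge_atTop n₀] with n hn
      have : ¬ (n : ℝ) < |ψ x| := not_lt.2 (hn₀.trans (by exact_mod_cast hn))
      simp [hψt, this]
  refine ENNReal.tendsto_nhds_zero.2 fun η hη => ?_
  have hη2 : 0 < η / 2 := ENNReal.half_pos hη.ne'
  have h1 := ENNReal.Tendsto.const_mul htail (Or.inr (ENNReal.ofReal_ne_top (r := C)))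
  rw [mul_zero] at h1
  obtain ⟨n, hn⟩ := (ENNReal.tendsto_nhds_zero.1 h1 _ hη2).exists
  have h2 := ENNReal.Tendsto.const_mul (hK.tendsto_lintegral_sum_sq π ν hpos hzero hinf hR hRb)
    (Or.inr (ENNReal.ofReal_ne_top (r := (n : ℝ) ^ 2)))
  rw [mul_zero] at h2
  filter_upwards [ENNReal.tendsto_nhds_zero.1 h2 _ hη2] with ℓ hℓ
  have hm : Measurable fun q : 𝒟 × (Option (Fin ℓ) → 𝒮) => ENNReal.ofReal
      (∑ j, nbrWeight (scaled K (h ℓ)) (R q.1 ∘ q.2) (none : Option (Fin ℓ)) j ^ 2) :=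
    ENNReal.measurable_ofReal.comp (Finset.measurable_fun_sum _ fun j _ =>
      (measurable_nbrWeight_sample hR (hK.measurable_scaled _) _ j).pow_const 2)
  rw [hdiag ℓ, ← ENNReal.add_halves η]
  calc _ ≤ ∫⁻ q, (ENNReal.ofReal ((n : ℝ) ^ 2) * ENNReal.ofReal
          (∑ j, nbrWeight (scaled K (h ℓ)) (R q.1 ∘ q.2) (none : Option (Fin ℓ)) j ^ 2) +
          ENNReal.ofReal (kernelAverage (scaled K (h ℓ)) R none (fun x => |ψt n x|) q ^ 2))
          ∂(π.prod (Measure.pi fun _ => ν)) := by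
        refine lintegral_mono fun q => ?_
        set W := nbrWeight (scaled K (h ℓ)) (R q.1 ∘ q.2) (none : Option (Fin ℓ)) with hW
        have hW0 : ∀ j, 0 ≤ W j := nbrWeight_nonneg (hK.scaled_nonneg _) _ _
        rw [← ENNReal.ofReal_mul (by positivity), ← ENNReal.ofReal_add
          (mul_nonneg (by positivity) (Finset.sum_nonneg fun j _ => sq_nonneg _)) (sq_nonneg _)]
        refine ENNReal.ofReal_le_ofReal ?_
        have h3 : ∑ j, (W j * |ψt n (q.1, q.2 j)|) ^ 2 ≤
            kernelAverage (scaled K (h ℓ)) R none (fun x => |ψt n x|) q ^ 2 :=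
          Finset.sum_sq_le_sq_sum_of_nonneg fun j _ => mul_nonneg (hW0 j) (abs_nonneg _)
        refine le_trans ?_ (add_le_add_right h3 _)
        rw [Finset.mul_sum, ← Finset.sum_add_distrib]
        refine Finset.sum_le_sum fun j _ => ?_
        rw [mul_pow, mul_pow, sq_abs]
        by_cases hj : (n : ℝ) < |ψ (q.1, q.2 j)|
        · have : ψt n (q.1, q.2 j) = ψ (q.1, q.2 j) := 
            Set.indicator_of_mem (s := {x | (n : ℝ) < |ψ x|}) hj ψ
          rw [this]
          have : 0 ≤ (n : ℝ) ^ 2 * W j ^ 2 := by positivity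
          linarith
        · have h4 : ψ (q.1, q.2 j) ^ 2 ≤ (n : ℝ) ^ 2 :=
            sq_le_sq.2 ((not_lt.1 hj).trans (le_abs_self _))
          have := mul_le_mul_of_nonneg_left h4 (sq_nonneg (W j))
          have : 0 ≤ W j ^ 2 * ψt n (q.1, q.2 j) ^ 2 := by positivity
          linarith
    _ = _ + _ := lintegral_add_left (hm.const_mul _) _
    _ ≤ η / 2 + η / 2 := by
        refine add_le_add ?_ ?_
        · rw [lintegral_const_mul _ hm]
          exact hℓ
        · exact (hbound (h ℓ) (hpos ℓ) none (ψt n) (hψtm n)).trans hn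

/-- Consistency of the kernel average of the responses `φ`, where `c` is the conditional expectation
of `φ` given the data and the prediction. -/
lemma IsRegularKernel.tendsto_secondMoment_sub_condExp [MetricSpace 𝒟] [SecondCountableTopology 𝒟]
    [BorelSpace 𝒟] (hK : IsRegularKernel K)
    (hpos : ∀ ℓ, 0 < h ℓ) (hzero : Tendsto h atTop (𝓝 0))
    (hinf : Tendsto (fun ℓ : ℕ => h ℓ ^ M * (ℓ : ℝ)) atTop atTop)
    (hR : Measurable fun q : 𝒟 × 𝒮 => R q.1 q.2) (hRb : ∀ D, ∃ C, ∀ s, ‖R D s‖ ≤ C)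
    {c : 𝒟 × E M → ℝ} (hc : Measurable c)
    (hc2 : MemLp (fun x : 𝒟 × 𝒮 => c (x.1, R x.1 x.2)) 2 (π.prod ν))
    {φ : 𝒟 × 𝒮 → ℝ} (hφ : Measurable φ) (hφ2 : MemLp φ 2 (π.prod ν))
    (hort : ∀ G : 𝒟 × E M → ℝ, Measurable G →
      ∫ x, G (x.1, R x.1 x.2) * (φ x - c (x.1, R x.1 x.2)) ∂(π.prod ν) = 0) :
    Tendsto (fun ℓ : ℕ => secondMoment (π.prod (Measure.pi fun _ => ν)) fun q =>
      kernelAverage (scaled K (h ℓ)) R (none : Option (Fin ℓ)) φ q -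
        c (q.1, R q.1 (q.2 none))) atTop (𝓝 0) := by
  have hcΦ : Measurable fun x : 𝒟 × 𝒮 => c (x.1, R x.1 x.2) := hc.comp (measurable_fst.prodMk hR)
  set ψ : 𝒟 × 𝒮 → ℝ := fun x => φ x - c (x.1, R x.1 x.2) with hψ
  have hψm : Measurable ψ := hφ.sub hcΦ
  have h1 := hK.tendsto_secondMoment_of_memLp π ν hpos hzero hinf hR hRb hc hc2
  have h2 := hK.tendsto_secondMoment_of_orthogonal π ν hpos hzero hinf hR hRb hψm
    (hφ2.sub hc2) hort
  have h3 := (ENNReal.Tendsto.const_mul h1 (a := 2) (by simp)).add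
    (ENNReal.Tendsto.const_mul h2 (a := 2) (by simp))
  rw [mul_zero, add_zero] at h3
  refine tendsto_of_tendsto_of_tendsto_of_le_of_le tendsto_const_nhds h3 (fun _ => zero_le)
    fun ℓ => ?_
  have hk := hK.measurable_scaled (h ℓ)
  have hev := measurePreserving_prod_eval π ν (none : Option (Fin ℓ))
  refine le_trans (le_of_eq ?_) (secondMoment_add_le ((measurable_kernelAverage hR hk none hcΦ).sub
    (hcΦ.comp hev.measurable)) _)
  congr 1
  funext q
  have hadd := kernelAverage_add (R := R) (scaled K (h ℓ)) none
    (fun x => c (x.1, R x.1 x.2)) ψ q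
  have hφψ : (fun x : 𝒟 × 𝒮 => c (x.1, R x.1 x.2) + ψ x) = φ := by
    funext x; simp only [hψ]; ring
  rw [hφψ] at hadd
  rw [hadd]
  simp only [Pi.sub_apply, Function.comp_apply]
  ring

end Consistency

/-! ### Conditional expectations as projections -/

section Projection

variable {Ω : Type*} {m m0 : MeasurableSpace Ω} {μ : Measure Ω}

/-- The error of a conditional expectation is orthogonal to the conditioning `σ`-algebra. Without
integrability of the product the integral is zero by convention. -/
lemma integral_mul_sub_condExp_eq_zero [IsFiniteMeasure μ] (hm : m ≤ m0) {Y f : Ω → ℝ}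
    (hY : Integrable Y μ) (hf : StronglyMeasurable[m] f) : ∫ ω, f ω * (Y ω - (μ[Y | m]) ω) ∂μ = 0 := by
  by_cases hint : Integrable (f * (Y - μ[Y | m])) μ
  · have h1 := condExp_mul_of_stronglyMeasurable_left hf hint (hY.sub integrable_condExp)
    have h2 : μ[Y - μ[Y | m] | m] =ᵐ[μ] 0 := by
      refine (condExp_sub hY integrable_condExp m).trans ?_
      rw [condExp_of_stronglyMeasurable hm stronglyMeasurable_condExp integrable_condExp, sub_self]
    change ∫ ω, (f * (Y - μ[Y | m])) ω ∂μ = 0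
    rw [← integral_condExp hm]
    refine integral_eq_zero_of_ae (h1.trans ?_)
    filter_upwards [h2] with ω hω
    simp [hω]
  · exact integral_undef hint

/-- Pythagoras: `a` is at least as close to `b` as `c` is, when `c - a` is orthogonal to
`b - a`. -/
lemma secondMoment_sub_le_of_orthogonal {a b c : Ω → ℝ} (ha : MemLp a 2 μ) (hb : MemLp b 2 μ)
    (hc : MemLp c 2 μ) (h : ∫ ω, (c ω - a ω) * (b ω - a ω) ∂μ = 0) :
    secondMoment μ (fun ω => a ω - b ω) ≤ secondMoment μ (fun ω => c ω - b ω) := by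
  have hab := (ha.sub hb).integrable_sq
  have hcb := (hc.sub hb).integrable_sq
  have hca := (hc.sub ha).integrable_sq
  have hx : Integrable (fun ω => (c ω - a ω) * (b ω - a ω)) μ :=
    (hc.sub ha).integrable_mul (hb.sub ha)
  simp only [Pi.sub_apply] at hab hcb hca
  rw [secondMoment, secondMoment, ← ofReal_integral_eq_lintegral_ofReal hab
    (Eventually.of_forall fun _ => sq_nonneg _), ← ofReal_integral_eq_lintegral_ofReal hcb
    (Eventually.of_forall fun _ => sq_nonneg _)]
  refine ENNReal.ofReal_le_ofReal ?_
  have hexp : ∫ ω, (c ω - b ω) ^ 2 ∂μ = ∫ ω, (((c ω - a ω) ^ 2 + (a ω - b ω) ^ 2) -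
      2 * ((c ω - a ω) * (b ω - a ω))) ∂μ := by
    congr 1; funext ω; ring
  have hsum : Integrable (fun ω => (c ω - a ω) ^ 2 + (a ω - b ω) ^ 2) μ := hca.add hab
  rw [hexp, integral_sub hsum (hx.const_mul 2), integral_add hca hab, integral_const_mul,
    h, mul_zero, sub_zero]
  have : 0 ≤ ∫ ω, (c ω - a ω) ^ 2 ∂μ := integral_nonneg fun _ => sq_nonneg _
  linarith

lemma risk_eq_secondMoment (μ : Measure Ω) (U V : Ω → ℝ) :
    risk μ U V = secondMoment μ fun ω => U ω - V ω := by
  simp only [risk, secondMoment, sq_abs]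

/-- The limit of a sequence of estimators in `L²` dominates the upper limit of their risks. -/
lemma limsup_risk_le {U : ℕ → Ω → ℝ} {V b : Ω → ℝ} (hU : ∀ ℓ, AEStronglyMeasurable (U ℓ) μ)
    (hV : AEStronglyMeasurable V μ) (hb : AEStronglyMeasurable b μ)
    (hlim : Tendsto (fun ℓ => risk μ (U ℓ) V) atTop (𝓝 0)) :
    limsup (fun ℓ => risk μ (U ℓ) b) atTop ≤ risk μ V b := by
  simp only [risk_eq_secondMoment, secondMoment_eq_eLpNorm_sq] at hlim ⊢
  have hlim1 : Tendsto (fun ℓ => eLpNorm (fun ω => U ℓ ω - V ω) 2 μ) atTop (𝓝 0) := by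
    have h1 := (ENNReal.continuous_rpow_const (y := 1 / 2)).tendsto 0 |>.comp hlim
    simp only [Function.comp_def, ← ENNReal.rpow_natCast, ← ENNReal.rpow_mul] at h1
    simpa using h1
  have hlim2 : Tendsto (fun ℓ => (eLpNorm (fun ω => U ℓ ω - V ω) 2 μ +
      eLpNorm (fun ω => V ω - b ω) 2 μ) ^ 2) atTop
      (𝓝 ((0 + eLpNorm (fun ω => V ω - b ω) 2 μ) ^ 2)) :=
    ((ENNReal.continuous_pow 2).tendsto _).comp (hlim1.add tendsto_const_nhds)
  rw [zero_add] at hlim2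
  rw [← hlim2.limsup_eq]
  refine limsup_le_limsup (Eventually.of_forall fun ℓ => pow_le_pow_left' ?_ 2)
  have := eLpNorm_add_le ((hU ℓ).sub hV) (hV.sub hb) (p := 2) one_le_two
  refine le_trans (le_of_eq ?_) this
  congr 1
  funext ω
  simp

end Projection

/-! ### From the random sample to product measures -/

section Estimator

variable {Ω : Type*} {d M k : ℕ} {X : Ω → E d} {Y : Ω → ℝ} {S : ℕ → Ω → E d × ℝ}

/-- The second sample, together with the generic couple as the test point. -/
def augmentedSample (X : Ω → E d) (Y : Ω → ℝ) (S : ℕ → Ω → E d × ℝ) (k ℓ : ℕ) (ω : Ω) :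
    Option (Fin ℓ) → E d × ℝ :=
  fun o => o.elim (X ω, Y ω) fun i => S (k + i) ω

/-- The aggregated estimator is the leave-one-out kernel average at the test point. -/
lemma gn_eq_kernelAverage (K : E M → ℝ) (h : ℝ) (ℓ : ℕ)
    (r : (Fin k → E d × ℝ) → Fin M → E d → ℝ) (ω : Ω) :
    gn K h ℓ r X S ω = kernelAverage (scaled K h) (fun D s => predictions (r D) s.1)
      (none : Option (Fin ℓ)) (fun x => x.2.2) (sampleK S k ω, augmentedSample X Y S k ℓ ω) := by
  have hden : ∀ f : Option (Fin ℓ) → ℝ,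
      ∑ l ∈ Finset.univ.erase none, f l = ∑ i : Fin ℓ, f (some i) := by
    intro f
    have := Finset.add_sum_erase Finset.univ f (Finset.mem_univ none)
    rw [Fintype.sum_option] at this
    exact add_left_cancel this
  simp only [kernelAverage, Fintype.sum_option, nbrWeight, hden]
  simp [gn, aggregate, weight, scaled, sampleL, augmentedSample]

end Estimator

section Transfer

variable {Ω : Type*} [MeasurableSpace Ω] {μ : Measure Ω} [IsProbabilityMeasure μ] {d M k : ℕ}
  {X : Ω → E d} {Y : Ω → ℝ} {S : ℕ → Ω → E d × ℝ}

/-- The data `D_k` and the augmented sample are independent, with iid entries. -/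
lemma IsIIDSample.measurePreserving (hS : IsIIDSample μ X Y S) (hX : Measurable X)
    (hY : Measurable Y) (k ℓ : ℕ) :
    MeasurePreserving (fun ω => (sampleK S k ω, augmentedSample X Y S k ℓ ω)) μ
      ((Measure.pi fun _ : Fin k => μ.map fun ω => (X ω, Y ω)).prod
        (Measure.pi fun _ : Option (Fin ℓ) => μ.map fun ω => (X ω, Y ω))) := by
  have hXY : Measurable fun ω => (X ω, Y ω) := hX.prodMk hY
  have : IsProbabilityMeasure (μ.map fun ω => (X ω, Y ω)) :=
    Measure.isProbabilityMeasure_map hXY.aemeasurable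
  set T : Option ℕ → Ω → E d × ℝ := fun o => o.elim (fun ω => (X ω, Y ω)) S with hT
  have hTm : ∀ o, Measurable (T o) := by
    rintro (_ | i)
    · exact hXY
    · exact hS.measurable i
  have hTmap : ∀ o, μ.map (T o) = μ.map fun ω => (X ω, Y ω) := by
    rintro (_ | i)
    · rfl
    · exact (hS.identDistrib i).map_eq
  set g : Fin k ⊕ Option (Fin ℓ) → Option ℕ :=
    Sum.elim (fun i => some (i : ℕ)) (Option.map fun i : Fin ℓ => k + (i : ℕ)) with hg
  have hginj : g.Injective := by
    rintro (i | _ | i) (j | _ | j) hij <;> simp [hg] at hij ⊢ <;> omega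
  have hind := hS.indep.precomp hginj
  have hmap := (iIndepFun_iff_map_fun_eq_pi_map fun j => (hTm (g j)).aemeasurable).1 hind
  simp only [hTmap] at hmap
  have h1 : MeasurePreserving (fun ω j => T (g j) ω) μ
      (Measure.pi fun _ : Fin k ⊕ Option (Fin ℓ) => μ.map fun ω => (X ω, Y ω)) :=
    ⟨measurable_pi_iff.2 fun j => hTm (g j), hmap⟩
  have h2 := measurePreserving_sumPiEquivProdPi
    (fun _ : Fin k ⊕ Option (Fin ℓ) => μ.map fun ω => (X ω, Y ω))
  have h3 := h2.comp h1
  convert h3 using 1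
  funext ω
  refine Prod.ext rfl ?_
  funext o
  cases o <;> rfl

lemma IsIIDSample.measurePreserving_couple (hS : IsIIDSample μ X Y S) (hX : Measurable X)
    (hY : Measurable Y) (k : ℕ) :
    MeasurePreserving (fun ω => (sampleK S k ω, (X ω, Y ω))) μ
      ((Measure.pi fun _ : Fin k => μ.map fun ω => (X ω, Y ω)).prod
        (μ.map fun ω => (X ω, Y ω))) := by
  have : IsProbabilityMeasure (μ.map fun ω => (X ω, Y ω)) :=
    Measure.isProbabilityMeasure_map (hX.prodMk hY).aemeasurable
  exact (measurePreserving_prod_eval _ _ none).comp (hS.measurePreserving hX hY k 0)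

lemma measurable_predictions_apply {r : (Fin k → E d × ℝ) → Fin M → E d → ℝ}
    (hr : ∀ m, Measurable (fun q : (Fin k → E d × ℝ) × E d => r q.1 m q.2)) :
    Measurable fun q : (Fin k → E d × ℝ) × (E d × ℝ) => predictions (r q.1) q.2.1 :=
  (WithLp.measurable_toLp 2 _).comp (measurable_pi_iff.2 fun m =>
    (hr m).comp (measurable_fst.prodMk (measurable_fst.comp measurable_snd)))

lemma exists_norm_predictions_le {r : Fin M → E d → ℝ} (hr : ∀ m, ∃ C : ℝ, ∀ x, |r m x| ≤ C) :
    ∃ C, ∀ x, ‖predictions r x‖ ≤ C := by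
  choose C hC using hr
  refine ⟨√(∑ m, C m ^ 2), fun x => ?_⟩
  rw [EuclideanSpace.norm_eq]
  refine Real.sqrt_le_sqrt (Finset.sum_le_sum fun m _ => ?_)
  exact pow_le_pow_left₀ (norm_nonneg _) (hC m x) 2

/-- Given the covariate `X`, the data `D_k` carry no information on `Y`. -/
lemma IsIIDSample.integral_mul_sub_gstarX_eq_zero (hS : IsIIDSample μ X Y S) (hX : Measurable X)
    (hY : Measurable Y) (hY2 : Integrable Y μ) {H : (Fin k → E d × ℝ) × E d → ℝ}
    (hH : Measurable H) :
    ∫ ω, H (sampleK S k ω, X ω) * (Y ω - gstarX μ X Y ω) ∂μ = 0 := by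
  have hXY : Measurable fun ω => (X ω, Y ω) := hX.prodMk hY
  have : IsProbabilityMeasure (μ.map fun ω => (X ω, Y ω)) :=
    Measure.isProbabilityMeasure_map hXY.aemeasurable
  obtain ⟨g, hg, hgX⟩ := (stronglyMeasurable_condExp (μ := μ) (f := Y)
    (m := MeasurableSpace.comap X inferInstance)).measurable.exists_eq_measurable_comp
  have hgX' : ∀ ω, gstarX μ X Y ω = g (X ω) := fun ω => congrFun hgX ω
  have hmp := hS.measurePreserving_couple hX hY k
  set ν := μ.map fun ω => (X ω, Y ω) with hν
  set π := Measure.pi fun _ : Fin k => ν with hπ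
  set F : (Fin k → E d × ℝ) × (E d × ℝ) → ℝ := fun x => H (x.1, x.2.1) * (x.2.2 - g x.2.1) with hF
  have hFm : Measurable F := (hH.comp (measurable_fst.prodMk measurable_snd.fst)).mul
    (measurable_snd.snd.sub (hg.comp measurable_snd.fst))
  have h1 : ∫ ω, H (sampleK S k ω, X ω) * (Y ω - gstarX μ X Y ω) ∂μ = ∫ x, F x ∂(π.prod ν) := by
    rw [← hmp.map_eq, integral_map hmp.measurable.aemeasurable hFm.aestronglyMeasurable]
    simp only [hF, hgX']
  rw [h1]
  by_cases hint : Integrable F (π.prod ν)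
  swap
  · exact integral_undef hint
  rw [integral_prod _ hint]
  refine integral_eq_zero_of_ae (Eventually.of_forall fun D => ?_)
  have hFD : Measurable fun s => F (D, s) := hFm.comp measurable_prodMk_left
  have h2 : ∫ s, F (D, s) ∂ν = ∫ ω, H (D, X ω) * (Y ω - gstarX μ X Y ω) ∂μ := by
    rw [hν, integral_map hXY.aemeasurable hFD.aestronglyMeasurable]
    simp only [hF, hgX']
  simp only [h2, Pi.zero_apply]
  refine integral_mul_sub_condExp_eq_zero hX.comap_le hY2 ?_
  exact ((hH.comp measurable_prodMk_left).comp (comap_measurable X)).stronglyMeasurable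

end Transfer

end KernelAggregation

/-! ### Consistency and oracle inequality -/

open KernelAggregation

theorem proposition2 {Ω : Type*} [MeasurableSpace Ω] (μ : Measure Ω) [IsProbabilityMeasure μ]
    (d M k : ℕ) (hM : 1 ≤ M)
    -- the regular kernel and the bandwidths `h ℓ`
    (K : KernelAggregation.E M → ℝ) (hK : KernelAggregation.IsRegularKernel K)
    (h : ℕ → ℝ) (hpos : ∀ ℓ, 0 < h ℓ) (hzero : Tendsto h atTop (𝓝 0))
    (hinf : Tendsto (fun ℓ : ℕ => h ℓ ^ M * (ℓ : ℝ)) atTop atTop)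
    -- the generic couple and the training data
    (X : Ω → KernelAggregation.E d) (Y : Ω → ℝ) (hX : Measurable X) (hY : Measurable Y)
    (hY2 : MemLp Y 2 μ)
    (S : ℕ → Ω → KernelAggregation.E d × ℝ) (hS : KernelAggregation.IsIIDSample μ X Y S)
    -- the basic estimators, built from `k` observations and bounded as functions of `x`
    (r : (Fin k → KernelAggregation.E d × ℝ) → Fin M → KernelAggregation.E d → ℝ)
    (hr : ∀ m, Measurable
      (fun q : (Fin k → KernelAggregation.E d × ℝ) × KernelAggregation.E d => r q.1 m q.2))
    (hbdd : ∀ D m, ∃ C : ℝ, ∀ x, |r D m x| ≤ C) :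
    Tendsto (fun ℓ : ℕ => KernelAggregation.risk μ (KernelAggregation.gn K (h ℓ) ℓ r X S)
      (KernelAggregation.gstarPred μ r X Y S)) atTop (𝓝 0) ∧
    limsup (fun ℓ : ℕ => KernelAggregation.risk μ (KernelAggregation.gn K (h ℓ) ℓ r X S)
        (KernelAggregation.gstarX μ X Y)) atTop ≤
      ⨅ f ∈ KernelAggregation.classG μ r X S, KernelAggregation.risk μ
        (fun ω => f (KernelAggregation.predX r X S ω)) (KernelAggregation.gstarX μ X Y) ∧
    (⨅ f ∈ KernelAggregation.classG μ r X S, KernelAggregation.risk μ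
        (fun ω => f (KernelAggregation.predX r X S ω)) (KernelAggregation.gstarX μ X Y)) ≤
      ⨅ m : Fin M, KernelAggregation.risk μ
        (fun ω => r (KernelAggregation.sampleK S k ω) m (X ω)) (KernelAggregation.gstarX μ X Y) ∧
    limsup (fun ℓ : ℕ => KernelAggregation.risk μ (KernelAggregation.gn K (h ℓ) ℓ r X S)
        (KernelAggregation.gstarX μ X Y)) atTop ≤
      ⨅ m : Fin M, KernelAggregation.risk μ
        (fun ω => r (KernelAggregation.sampleK S k ω) m (X ω)) (KernelAggregation.gstarX μ X Y) := by
  have hXY : Measurable fun ω => (X ω, Y ω) := hX.prodMk hY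
  have hν : IsProbabilityMeasure (μ.map fun ω => (X ω, Y ω)) :=
    Measure.isProbabilityMeasure_map hXY.aemeasurable
  set ν := μ.map fun ω => (X ω, Y ω) with hν_def
  set π := Measure.pi fun _ : Fin k => ν with hπ
  set R : (Fin k → E d × ℝ) → E d × ℝ →
    E M := fun D s => predictions (r D) s.1 with hR_def
  have hR : Measurable fun q : (Fin k → E d × ℝ) × (E d × ℝ) =>
      R q.1 q.2 := measurable_predictions_apply hr
  have hRb : ∀ D, ∃ C, ∀ s, ‖R D s‖ ≤ C := fun D => by
    obtain ⟨C, hC⟩ := exists_norm_predictions_le (hbdd D)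
    exact ⟨C, fun s => hC s.1⟩
  have hmp := hS.measurePreserving_couple hX hY k
  have hYint : Integrable Y μ := hY2.integrable one_le_two
  -- the conditioning variables and the conditional expectation as a function of them
  set Q : Ω → (Fin k → E d × ℝ) × E M :=
    fun ω => (sampleK S k ω, predX r X S ω) with hQ
  have hQm : Measurable Q :=
    (measurable_fst.prodMk hR).comp hmp.measurable
  set gP := gstarPred μ r X Y S with hgP
  set gX := gstarX μ X Y with hgX
  have hgP2 : MemLp gP 2 μ := hY2.condExp one_le_two
  have hgX2 : MemLp gX 2 μ := hY2.condExp one_le_two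
  obtain ⟨c, hc, hcQ⟩ := (stronglyMeasurable_condExp (μ := μ) (f := Y)
    (m := MeasurableSpace.comap Q inferInstance)).measurable.exists_eq_measurable_comp
  have hcQ' : ∀ ω, gP ω = c (Q ω) := fun ω => congrFun hcQ ω
  have hortP : ∀ G : (Fin k → E d × ℝ) × E M → ℝ,
      Measurable G → ∫ ω, G (Q ω) * (Y ω - gP ω) ∂μ = 0 := fun G hG =>
    integral_mul_sub_condExp_eq_zero hQm.comap_le hYint
      (hG.comp (comap_measurable Q)).stronglyMeasurable
  have hΦ : Measurable fun x : (Fin k → E d × ℝ) × (E d × ℝ) =>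
      (x.1, R x.1 x.2) := measurable_fst.prodMk hR
  have hc2 : MemLp (fun x : (Fin k → E d × ℝ) × (E d × ℝ) =>
      c (x.1, R x.1 x.2)) 2 (π.prod ν) := by
    have hcΦ : Measurable fun x : (Fin k → E d × ℝ) ×
        (E d × ℝ) => c (x.1, R x.1 x.2) := hc.comp hΦ
    rw [← hmp.map_eq, memLp_map_measure_iff hcΦ.aestronglyMeasurable hmp.measurable.aemeasurable]
    exact hgP2.congr_norm (hc.comp hQm).aestronglyMeasurable
      (Eventually.of_forall fun ω => by rw [hcQ' ω]; rfl)
  have hφm : Measurable fun x : (Fin k → E d × ℝ) ×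
      (E d × ℝ) => x.2.2 := measurable_snd.snd
  have hφ2 : MemLp (fun x : (Fin k → E d × ℝ) × (E d × ℝ) =>
      x.2.2) 2 (π.prod ν) := by
    rw [← hmp.map_eq, memLp_map_measure_iff hφm.aestronglyMeasurable hmp.measurable.aemeasurable]
    exact hY2
  have hort : ∀ G : (Fin k → E d × ℝ) × E M → ℝ,
      Measurable G → ∫ x, G (x.1, R x.1 x.2) * (x.2.2 - c (x.1, R x.1 x.2)) ∂(π.prod ν) = 0 := by
    intro G hG
    have hGm : Measurable fun x : (Fin k → E d × ℝ) ×
        (E d × ℝ) => G (x.1, R x.1 x.2) * (x.2.2 - c (x.1, R x.1 x.2)) :=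
      (hG.comp hΦ).mul (hφm.sub (hc.comp hΦ))
    rw [← hmp.map_eq, integral_map hmp.measurable.aemeasurable hGm.aestronglyMeasurable]
    have := hortP G hG
    simp only [hcQ'] at this
    exact this
  have hk := fun ℓ => hK.measurable_scaled (h ℓ)
  have hgn : ∀ ℓ, gn K (h ℓ) ℓ r X S = fun ω =>
      kernelAverage (scaled K (h ℓ)) R
        (none : Option (Fin ℓ)) (fun x => x.2.2) (sampleK S k ω,
          augmentedSample X Y S k ℓ ω) := fun ℓ =>
    funext fun ω => gn_eq_kernelAverage K (h ℓ) ℓ r ω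
  have hgnm : ∀ ℓ, Measurable (gn K (h ℓ) ℓ r X S) := fun ℓ => by
    rw [hgn ℓ]
    exact (measurable_kernelAverage hR (hk ℓ) none hφm).comp
      (hS.measurePreserving hX hY k ℓ).measurable
  have hconsistent : Tendsto (fun ℓ : ℕ =>
      risk μ (gn K (h ℓ) ℓ r X S) gP) atTop (𝓝 0) := by
    have hmain := hK.tendsto_secondMoment_sub_condExp π ν hpos hzero hinf hR hRb hc hc2 hφm hφ2
      hort
    refine hmain.congr fun ℓ => ?_
    have hmpℓ := hS.measurePreserving hX hY k ℓ
    rw [risk_eq_secondMoment]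
    refine (secondMoment_comp hmpℓ
      ((measurable_kernelAverage hR (hk ℓ) none hφm).sub ((hc.comp hΦ).comp
        (measurePreserving_prod_eval π ν none).measurable))).symm.trans ?_
    congr 1
    funext ω
    rw [hgn ℓ, hcQ' ω]
    rfl
  have hlimsup := limsup_risk_le (fun ℓ => (hgnm ℓ).aestronglyMeasurable)
    hgP2.1 hgX2.1 hconsistent
  have hproj : ∀ f ∈ classG μ r X S, risk μ gP gX ≤
      risk μ (fun ω => f (predX r X S ω)) gX := by
    rintro f ⟨hf, hf2⟩
    have hfP : MemLp (fun ω => f (predX r X S ω)) 2 μ := by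
      have hfm : Measurable fun ω => f (predX r X S ω) :=
        hf.comp (measurable_snd.comp hQm)
      rw [memLp_two_iff_secondMoment hfm.aestronglyMeasurable]
      simpa only [secondMoment, sq_abs] using hf2
    rw [risk_eq_secondMoment, risk_eq_secondMoment]
    refine secondMoment_sub_le_of_orthogonal hgP2 hgX2 hfP ?_
    -- `b - a = (Y - a) - (Y - b)`, and both errors are orthogonal to `c - a`
    have h1 := hortP (fun y => f y.2 - c y) ((hf.comp measurable_snd).sub hc)
    have h2 := hS.integral_mul_sub_gstarX_eq_zero hX hY hYint (k := k)
      (H := fun q => f (predictions (r q.1) q.2) -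
        c (q.1, predictions (r q.1) q.2)) ?_
    · have hfa := hfP.sub hgP2
      have e1 : ∀ ω, f (Q ω).2 - c (Q ω) = f (predX r X S ω) - gP ω :=
        fun ω => by rw [hcQ' ω]
      have e2 : ∀ ω, f (predictions (r (sampleK S k ω)) (X ω)) -
          c (sampleK S k ω,
            predictions (r (sampleK S k ω)) (X ω)) =
          f (predX r X S ω) - gP ω := e1
      simp only [e1] at h1
      simp only [e2] at h2
      have i1 := hfa.integrable_mul (hY2.sub hgP2)
      have i2 := hfa.integrable_mul (hY2.sub hgX2)
      have h3 := integral_sub i1 i2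
      refine Eq.trans (integral_congr_ae (Eventually.of_forall fun ω => ?_))
        (h3.trans (by rw [sub_eq_zero]; exact h1.trans h2.symm))
      simp only [Pi.mul_apply, Pi.sub_apply]
      ring
    · have hp : Measurable fun q : (Fin k → E d × ℝ) × E d =>
          predictions (r q.1) q.2 :=
        (WithLp.measurable_toLp 2 _).comp (measurable_pi_iff.2 hr)
      exact (hf.comp hp).sub (hc.comp (measurable_fst.prodMk hp))
  have hinf_le : limsup (fun ℓ : ℕ => risk μ
      (gn K (h ℓ) ℓ r X S) gX) atTop ≤
      ⨅ f ∈ classG μ r X S, risk μ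
        (fun ω => f (predX r X S ω)) gX :=
    le_iInf₂ fun f hf => hlimsup.trans (hproj f hf)
  have hcoord : (⨅ f ∈ classG μ r X S, risk μ
      (fun ω => f (predX r X S ω)) gX) ≤ ⨅ m : Fin M, risk μ
        (fun ω => r (sampleK S k ω) m (X ω)) gX := by
    refine le_iInf fun m => ?_
    have hm : Measurable fun y : E M => y m :=
      (measurable_pi_apply m).comp (WithLp.measurable_ofLp 2 _)
    by_cases hG : (fun y : E M => y m) ∈ classG μ r X S
    · exact iInf₂_le _ hG
    -- a basic estimator of infinite second moment has infinite risk, since `g*(X)` is in `L²`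
    · have hrm : Measurable fun ω => r (sampleK S k ω) m (X ω) :=
        hm.comp (measurable_snd.comp hQm)
      refine le_of_le_of_eq le_top (Eq.symm (not_lt_top_iff.1 fun hlt => hG ⟨hm, ?_⟩))
      rw [risk_eq_secondMoment] at hlt
      have h1 := ((memLp_two_iff_secondMoment
        (hrm.aestronglyMeasurable.sub hgX2.1)).2 hlt).add hgX2
      have h2 : MemLp (fun ω => r (sampleK S k ω) m (X ω)) 2 μ :=
        h1.congr_norm hrm.aestronglyMeasurable (Eventually.of_forall fun ω => by simp)
      rw [memLp_two_iff_secondMoment hrm.aestronglyMeasurable] at h2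
      simp only [sq_abs]
      exact h2
  exact ⟨hconsistent, hinf_le, hcoord, hinf_le.trans hcoord⟩
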